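/- Let $\mu>0$ and $p\ge 5$ be real numbers. Let $D^{1,2}(\mathbb R^3)$ be the space of functions $u\in L^6(\mathbb R^3)$ whose weak gradient $\nabla u$ is in $L^2(\mathbb R^3)$ (equivalently, the completion of $C_c^\infty(\mathbb R^3)$ for the norm $\|\nabla u\|_{L^2}$), and let $$E=\Big\{u\in D^{1,2}(\mathbb R^3):\ \int_{\mathbb R^3}\int_{\mathbb R^3}\frac{u^2(x)\,u^2(y)}{|x-y|}\,dx\,dy<+\infty\Big\}.$$ Then the equation $$-\Delta u+\Big(u^2\star\frac{1}{4\pi|x|}\Big)u=\mu|u|^{p-1}u\qquad\text{in }\mathbb R^3$$ has no nontrivial weak solution $u:\mathbb R^3\to\mathbb R$ in $E\cap H^2_{loc}(\mathbb R^3)$. That is, if $u\in E\cap H^2_{loc}(\mathbb R^3)$ and, with $\phi_u=u^2\star\frac1{4\pi|x|}$, the functions $\phi_u u$ and $|u|^{p-1}u$ are locally integrable and $$\int_{\mathbb R^3}\nabla u\cdot\nabla\psi\,dx+\int_{\mathbb R^3}\phi_u\,u\,\psi\,dx=\mu\int_{\mathbb R^3}|u|^{p-1}u\,\psi\,dx\qquad\text{for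 all }\psi\in C_c^\infty(\mathbb R^3),$$ then $u=0$ almost everywhere. -/

import Mathlib

open MeasureTheory
open scoped ContDiff Convolution

noncomputable section

namespace SchrodingerPoissonSlater

/-- Euclidean space `ℝ³`. -/
abbrev R3 : Type := EuclideanSpace ℝ (Fin 3)

/-- Test functions: `C_c^∞(ℝ³)`. -/
structure IsTestFunction (ψ : R3 → ℝ) : Prop where
  smooth : ContDiff ℝ ∞ ψ
  compact : HasCompactSupport ψ

/-- The classical partial derivative `∂ᵢψ(x)` of a (smooth) function. -/
def partialDeriv (i : Fin 3) (ψ : R3 → ℝ) (x : R3) : ℝ :=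
  fderiv ℝ ψ x (EuclideanSpace.single i (1 : ℝ))

/-- `v` is the weak `i`-th partial derivative of `u`: both functions are locally integrable and
`∫ u ∂ᵢψ = - ∫ v ψ` for all `ψ ∈ C_c^∞(ℝ³)`. -/
structure HasWeakPartial (i : Fin 3) (u v : R3 → ℝ) : Prop where
  locallyIntegrable : LocallyIntegrable u volume
  locallyIntegrable_deriv : LocallyIntegrable v volume
  integral_eq : ∀ ψ : R3 → ℝ, IsTestFunction ψ →
    ∫ x, u x * partialDeriv i ψ x = - ∫ x, v x * ψ x

/-- `G = (G₁, G₂, G₃)` is the weak gradient of `u`. -/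
def HasWeakGradient (u : R3 → ℝ) (G : Fin 3 → R3 → ℝ) : Prop :=
  ∀ i, HasWeakPartial i u (G i)

/-- `D^{1,2}(ℝ³) = {u ∈ L⁶(ℝ³) : ∇u ∈ L²(ℝ³)}` (weak gradient, `6 = 2^*`), which is the
completion of `C_c^∞(ℝ³)` for the norm `‖∇u‖_{L²}`. -/
def MemD12 (u : R3 → ℝ) : Prop :=
  MemLp u 6 volume ∧ ∃ G : Fin 3 → R3 → ℝ, HasWeakGradient u G ∧ ∀ i, MemLp (G i) 2 volume

/-- The Coulomb energy `∫∫ u²(x) u²(y) / |x - y| dx dy ∈ [0, ∞]`. -/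
def coulombEnergy (u : R3 → ℝ) : ENNReal :=
  ∫⁻ x, ∫⁻ y, ENNReal.ofReal (u x ^ 2 * u y ^ 2 / ‖x - y‖)

/-- The space `E = {u ∈ D^{1,2}(ℝ³) : ∫∫ u²(x) u²(y) / |x - y| dx dy < ∞}`. -/
def MemE (u : R3 → ℝ) : Prop :=
  MemD12 u ∧ coulombEnergy u < ⊤

/-- `L²_loc(ℝ³)`. -/
def MemL2loc (u : R3 → ℝ) : Prop :=
  ∀ K : Set R3, IsCompact K → MemLp u 2 (volume.restrict K)

/-- `H²_loc(ℝ³)`: the function and its weak derivatives of order one and two are in `L²_loc`. -/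
def MemH2loc (u : R3 → ℝ) : Prop :=
  MemL2loc u ∧ ∃ (G : Fin 3 → R3 → ℝ) (H : Fin 3 → Fin 3 → R3 → ℝ),
    HasWeakGradient u G ∧ (∀ i, MemL2loc (G i)) ∧
    (∀ i, HasWeakGradient (G i) (H i)) ∧ ∀ i j, MemL2loc (H i j)

/-- The potential `φ_u = u² ⋆ 1/(4π|x|)`. -/
def potential (u : R3 → ℝ) : R3 → ℝ :=
  (fun y => u y ^ 2) ⋆ (fun z => 1 / (4 * Real.pi * ‖z‖))

theorem potential_apply (u : R3 → ℝ) (x : R3) :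
    potential u x = ∫ y, u y ^ 2 * (1 / (4 * Real.pi * ‖x - y‖)) := rfl

/-- `u` is a weak solution of `-Δu + (u² ⋆ 1/(4π|x|)) u = μ |u|^{p-1} u` in `ℝ³`: all the terms
are distributions (locally integrable functions), and
`∫ ∇u · ∇ψ + ∫ φ_u u ψ = μ ∫ |u|^{p-1} u ψ` for all `ψ ∈ C_c^∞(ℝ³)`. -/
structure IsWeakSolution (μ p : ℝ) (u : R3 → ℝ) : Prop where
  locallyIntegrable_potential : LocallyIntegrable (fun x => potential u x * u x) volume
  locallyIntegrable_power : LocallyIntegrable (fun x => |u x| ^ (p - 1) * u x) volume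
  equation : ∃ G : Fin 3 → R3 → ℝ, HasWeakGradient u G ∧
    ∀ ψ : R3 → ℝ, IsTestFunction ψ →
      (∫ x, ∑ i, G i x * partialDeriv i ψ x) + (∫ x, potential u x * u x * ψ x)
        = μ * ∫ x, |u x| ^ (p - 1) * u x * ψ x

end SchrodingerPoissonSlater

end

section

open MeasureTheory Filter Topology
open scoped ContDiff Convolution ENNReal

noncomputable section

namespace SchrodingerPoissonSlater

/-! ### Calculus of partial derivatives -/

/-! The proof is a Pohozaev argument: the equation is multiplied by `x·∇u + u/2`. In dimension three
the two contributions of the Laplacian, `½∫|∇u|²` and `-½∫|∇u|²`, cancel. With `D = ∫∫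
u²(x)u²(y)/|x-y|`, what is left is formally `-(3/2) D = 8πμ (1/2 - 3/(p+1)) ∫|u|^{p+1}`. For `p ≥ 5`
the right side is nonnegative, so `D ≤ 0`, which forces `u = 0`.

Nothing makes `∫|u|^{p+1}` finite over the whole space, so the identity is localized with the field
`χ(x) x` (`IsH2loc.pohozaev`). A radially decreasing `χ` has `div(χ x) ≤ 3χ`, so the power term is
already nonnegative for each cutoff and its limit is never needed. The gradient terms carry a
derivative of `χ`; they vanish under dilation of `χ` because `∇u ∈ L²` and `u ∈ L⁶`
(`tendsto_gradientError`). The Coulomb term converges by dominated convergence, since `D < ∞` and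
the dilated fields are uniformly Lipschitz (`tendsto_integral_kernel`).

The local computations rest on `H²_loc ⊆ L^∞_loc`, obtained by Fourier transform
(`exists_forall_schwartz_norm_le`, `IsH2loc.exists_ae_abs_le`). It puts every power of `|u|` in
`L²_loc`; the equation then holds almost everywhere and puts `φ_u u` in `L²_loc`. Integrations by
parts are done on mollifications and passed to the limit. For the nonlocal term (`IsH2loc.nonlocal`)
the kernel `1/|z|` is first replaced by `(|z|²+δ²)^{-1/2}`. Its gradient is too singular as `δ → 0`,
but symmetrizing in `x` and `y` produces `(X(x)-X(y))·(x-y) = O(|x-y|²)`, which restores domination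
by the Coulomb density. -/

lemma contDiff_partialDeriv {f : R3 → ℝ} (hf : ContDiff ℝ ∞ f) (i : Fin 3) :
    ContDiff ℝ ∞ (partialDeriv i f) :=
  (hf.fderiv_right (m := ∞) (by simp)).clm_apply contDiff_const

lemma hasCompactSupport_partialDeriv {f : R3 → ℝ} (hf : HasCompactSupport f) (i : Fin 3) :
    HasCompactSupport (partialDeriv i f) :=
  hf.fderiv_apply (𝕜 := ℝ) _

lemma IsTestFunction.pderiv {f : R3 → ℝ} (hf : IsTestFunction f) (i : Fin 3) :
    IsTestFunction (partialDeriv i f) :=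
  ⟨contDiff_partialDeriv hf.smooth i, hasCompactSupport_partialDeriv hf.compact i⟩

lemma IsTestFunction.mul_right {f g : R3 → ℝ} (hf : IsTestFunction f) (hg : ContDiff ℝ ∞ g) :
    IsTestFunction (fun x => f x * g x) :=
  ⟨hf.smooth.mul hg, hf.compact.mul_right⟩

lemma differentiable_of_smooth {f : R3 → ℝ} (hf : ContDiff ℝ ∞ f) : Differentiable ℝ f :=
  hf.differentiable (by simp)

lemma partialDeriv_mul {f g : R3 → ℝ} (hf : ContDiff ℝ ∞ f) (hg : ContDiff ℝ ∞ g) (i : Fin 3)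
    (x : R3) : partialDeriv i (fun x => f x * g x) x
      = partialDeriv i f x * g x + f x * partialDeriv i g x := by
  have h := ((differentiable_of_smooth hf x).hasFDerivAt.mul
    (differentiable_of_smooth hg x).hasFDerivAt).fderiv
  change fderiv ℝ (f * g) x _ = _
  rw [h]
  simp [partialDeriv]
  ring

lemma partialDeriv_add {f g : R3 → ℝ} (hf : ContDiff ℝ ∞ f) (hg : ContDiff ℝ ∞ g) (i : Fin 3)
    (x : R3) : partialDeriv i (fun x => f x + g x) x = partialDeriv i f x + partialDeriv i g x := by
  simp only [partialDeriv]
  rw [fderiv_fun_add (differentiable_of_smooth hf x) (differentiable_of_smooth hg x)]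
  simp

lemma contDiff_coord (j : Fin 3) : ContDiff ℝ ∞ (fun x : R3 => x j) :=
  (EuclideanSpace.proj (𝕜 := ℝ) j : R3 →L[ℝ] ℝ).contDiff

lemma partialDeriv_coord (i j : Fin 3) (x : R3) :
    partialDeriv i (fun x : R3 => x j) x = if j = i then 1 else 0 := by
  have : HasFDerivAt (fun x : R3 => x j) (EuclideanSpace.proj (𝕜 := ℝ) j : R3 →L[ℝ] ℝ) x :=
    (EuclideanSpace.proj (𝕜 := ℝ) j : R3 →L[ℝ] ℝ).hasFDerivAt
  simp only [partialDeriv]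
  rw [this.fderiv]
  simp

lemma partialDeriv_comm {f : R3 → ℝ} (hf : ContDiff ℝ ∞ f) (i j : Fin 3) (x : R3) :
    partialDeriv i (partialDeriv j f) x = partialDeriv j (partialDeriv i f) x := by
  have hd : DifferentiableAt ℝ (fderiv ℝ f) x :=
    (hf.fderiv_right (m := ∞) (by simp)).differentiable (by simp) x
  have key : ∀ k l : Fin 3, partialDeriv k (partialDeriv l f) x
      = fderiv ℝ (fderiv ℝ f) x (EuclideanSpace.single k 1) (EuclideanSpace.single l 1) := by
    intro k l
    have : HasFDerivAt (fun y => fderiv ℝ f y (EuclideanSpace.single l (1 : ℝ))) _ x :=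
      hd.hasFDerivAt.clm_apply (hasFDerivAt_const _ _)
    change fderiv ℝ (fun y => fderiv ℝ f y (EuclideanSpace.single l (1 : ℝ))) x _ = _
    rw [this.fderiv]
    simp
  rw [key, key]
  exact (hf.contDiffAt.isSymmSndFDerivAt (by
    rw [minSmoothness_of_isRCLikeNormedField]
    exact WithTop.coe_le_coe.2 (le_top : (2 : ℕ∞) ≤ ⊤))) _ _

/-! ### Convergence in `L²_loc` -/

lemma _root_.Continuous.memL2loc {f : R3 → ℝ} (hf : Continuous f) : MemL2loc f := fun _ hK =>
  (memLp_two_iff_integrable_sq (hf.aestronglyMeasurable)).2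
    ((hf.pow 2).continuousOn.integrableOn_compact hK)

lemma MemL2loc.aestronglyMeasurable {f : R3 → ℝ} (hf : MemL2loc f) :
    AEStronglyMeasurable f volume := by
  have : ∀ n : ℕ, AEStronglyMeasurable f (volume.restrict (Metric.closedBall (0 : R3) n)) :=
    fun n => (hf _ (isCompact_closedBall _ _)).1
  have h := (aestronglyMeasurable_iUnion_iff (μ := (volume : Measure R3)) (f := f)
    (s := fun n : ℕ => Metric.closedBall (0 : R3) n)).2 this
  rwa [Metric.iUnion_closedBall_nat, Measure.restrict_univ] at h

lemma MemL2loc.mul_continuous {f θ : R3 → ℝ} (hf : MemL2loc f) (hθ : Continuous θ) :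
    MemL2loc (fun x => θ x * f x) := by
  intro K hK
  obtain ⟨C, hC⟩ := hK.exists_bound_of_continuousOn hθ.continuousOn
  refine (hf K hK).of_le_mul (c := C) (hθ.aestronglyMeasurable.mul (hf K hK).1) ?_
  filter_upwards [ae_restrict_mem hK.measurableSet] with x hx
  rw [norm_mul]
  exact mul_le_mul_of_nonneg_right (hC x hx) (norm_nonneg _)

lemma MemL2loc.add {f g : R3 → ℝ} (hf : MemL2loc f) (hg : MemL2loc g) :
    MemL2loc (fun x => f x + g x) := fun K hK => (hf K hK).add (hg K hK)

lemma MemL2loc.sum {ι : Type*} (s : Finset ι) {f : ι → R3 → ℝ} (hf : ∀ i ∈ s, MemL2loc (f i)) :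
    MemL2loc (fun x => ∑ i ∈ s, f i x) :=
  fun K hK => memLp_finsetSum s (fun i hi => hf i hi K hK)

lemma MemL2loc.congr {f g : R3 → ℝ} (hf : MemL2loc f) (h : f =ᵐ[volume] g) : MemL2loc g :=
  fun K hK => (memLp_congr_ae (ae_restrict_of_ae h)).1 (hf K hK)

lemma MemL2loc.integrableOn_mul {f g : R3 → ℝ} (hf : MemL2loc f) (hg : MemL2loc g) {K : Set R3}
    (hK : IsCompact K) : IntegrableOn (fun x => f x * g x) K volume :=
  MemLp.integrable_mul (hf K hK) (hg K hK)

lemma MemL2loc.locallyIntegrable {f : R3 → ℝ} (hf : MemL2loc f) : LocallyIntegrable f volume := by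
  rw [locallyIntegrable_iff]
  intro K hK
  simpa using (hf.integrableOn_mul (continuous_const (y := (1 : ℝ))).memL2loc hK)

lemma integrable_of_integrableOn_tsupport {f θ : R3 → ℝ}
    (h : ∀ x, θ x = 0 → f x = 0) (hf : IntegrableOn f (tsupport θ) volume) :
    Integrable f volume :=
  (integrableOn_iff_integrable_of_support_subset (fun x hx => subset_tsupport θ
    (fun h0 => hx (h x h0)))).1 hf

lemma MemL2loc.integrable_mul_mul {f g θ : R3 → ℝ} (hf : MemL2loc f) (hg : MemL2loc g)
    (hθ : Continuous θ) (hθc : HasCompactSupport θ) :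
    Integrable (fun x => θ x * f x * g x) volume :=
  integrable_of_integrableOn_tsupport (fun x hx => by simp [hx])
    ((hf.mul_continuous hθ).integrableOn_mul hg hθc)

/-- Convergence of a sequence of functions in `L²_loc(ℝ³)`. -/
def TendstoL2loc (a : ℕ → R3 → ℝ) (b : R3 → ℝ) : Prop :=
  ∀ K : Set R3, IsCompact K →
    Tendsto (fun n => eLpNorm (a n - b) 2 (volume.restrict K)) atTop (𝓝 0)

/-- Cauchy–Schwarz on each term of `(a - a₀)(b - b₀) + a₀(b - b₀) + (a - a₀)b₀`; with this splitting
no separate bound on the norms of `a n` and `b n` is required. -/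
lemma tendsto_eLpNorm_one_mul {α : Type*} [MeasurableSpace α] {μ : Measure α}
    {a b : ℕ → α → ℝ} {a₀ b₀ : α → ℝ} (ha : ∀ n, MemLp (a n) 2 μ) (hb : ∀ n, MemLp (b n) 2 μ)
    (ha₀ : MemLp a₀ 2 μ) (hb₀ : MemLp b₀ 2 μ)
    (hca : Tendsto (fun n => eLpNorm (a n - a₀) 2 μ) atTop (𝓝 0))
    (hcb : Tendsto (fun n => eLpNorm (b n - b₀) 2 μ) atTop (𝓝 0)) :
    Tendsto (fun n => eLpNorm (a n * b n - a₀ * b₀) 1 μ) atTop (𝓝 0) := by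
  have hmul : ∀ {f g : α → ℝ}, MemLp f 2 μ → MemLp g 2 μ →
      eLpNorm (f * g) 1 μ ≤ eLpNorm f 2 μ * eLpNorm g 2 μ := fun {f g} hf hg =>
    eLpNorm_smul_le_mul_eLpNorm (𝕜 := ℝ) (E := ℝ) (p := (2 : ℝ≥0∞)) (q := (2 : ℝ≥0∞))
      (r := (1 : ℝ≥0∞)) hg.1 hf.1
  have hlim : Tendsto (fun n => eLpNorm (a n - a₀) 2 μ * eLpNorm (b n - b₀) 2 μ
      + eLpNorm a₀ 2 μ * eLpNorm (b n - b₀) 2 μ + eLpNorm (a n - a₀) 2 μ * eLpNorm b₀ 2 μ)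
      atTop (𝓝 (0 * 0 + eLpNorm a₀ 2 μ * 0 + 0 * eLpNorm b₀ 2 μ)) := by
    refine ((ENNReal.Tendsto.mul hca (by simp) hcb (by simp)).add
      (ENNReal.Tendsto.const_mul hcb (Or.inr ha₀.2.ne))).add
      (ENNReal.Tendsto.mul_const hca (Or.inr hb₀.2.ne))
  simp only [mul_zero, zero_mul, add_zero] at hlim
  refine tendsto_of_tendsto_of_tendsto_of_le_of_le tendsto_const_nhds hlim
    (fun _ => zero_le) (fun n => ?_)
  have hdec : a n * b n - a₀ * b₀
      = ((a n - a₀) * (b n - b₀) + a₀ * (b n - b₀)) + (a n - a₀) * b₀ := by ring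
  have hA := (ha n).sub ha₀
  have hB := (hb n).sub hb₀
  rw [hdec]
  refine (eLpNorm_add_le ((hA.1.mul hB.1).add (ha₀.1.mul hB.1)) (hA.1.mul hb₀.1) le_rfl).trans ?_
  refine add_le_add ((eLpNorm_add_le (hA.1.mul hB.1) (ha₀.1.mul hB.1) le_rfl).trans ?_)
    (hmul hA hb₀)
  exact add_le_add (hmul hA hB) (hmul ha₀ hB)

/-- The device by which identities proved for mollifications pass to functions of class `H²_loc`. -/
lemma tendsto_integral_mul_mul {a b : ℕ → R3 → ℝ} {a₀ b₀ θ : R3 → ℝ}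
    (ha : ∀ n, MemL2loc (a n)) (hb : ∀ n, MemL2loc (b n)) (ha₀ : MemL2loc a₀) (hb₀ : MemL2loc b₀)
    (hca : TendstoL2loc a a₀) (hcb : TendstoL2loc b b₀)
    (hθ : Continuous θ) (hθc : HasCompactSupport θ) :
    Tendsto (fun n => ∫ x, θ x * a n x * b n x) atTop (𝓝 (∫ x, θ x * a₀ x * b₀ x)) := by
  set K := tsupport θ
  have hK : IsCompact K := hθc
  obtain ⟨C, hC⟩ := hK.exists_bound_of_continuousOn hθ.continuousOn
  have h1 := tendsto_eLpNorm_one_mul (fun n => ha n K hK) (fun n => hb n K hK) (ha₀ K hK)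
    (hb₀ K hK) (hca K hK) (hcb K hK)
  refine tendsto_integral_of_L1' _ (ha₀.integrable_mul_mul hb₀ hθ hθc).1
    (Eventually.of_forall fun n => (ha n).integrable_mul_mul (hb n) hθ hθc) ?_
  have h2 : Tendsto (fun n => ENNReal.ofReal C * eLpNorm (a n * b n - a₀ * b₀) 1
      (volume.restrict K)) atTop (𝓝 (ENNReal.ofReal C * 0)) :=
    ENNReal.Tendsto.const_mul h1 (Or.inr ENNReal.ofReal_ne_top)
  rw [mul_zero] at h2
  refine tendsto_of_tendsto_of_tendsto_of_le_of_le tendsto_const_nhds h2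
    (fun _ => zero_le) (fun n => ?_)
  have hsupp : Function.support ((fun x => θ x * a n x * b n x) - fun x => θ x * a₀ x * b₀ x)
      ⊆ K := by
    intro x hx
    refine subset_tsupport θ (fun h0 => hx ?_)
    simp [h0]
  rw [← eLpNorm_restrict_eq_of_support_subset hsupp]
  refine eLpNorm_le_mul_eLpNorm_of_ae_le_mul ?_ 1
  filter_upwards [ae_restrict_mem hK.measurableSet] with x hx
  have : θ x * a n x * b n x - θ x * a₀ x * b₀ x = θ x * (a n x * b n x - a₀ x * b₀ x) := by ring
  simp only [Pi.sub_apply, Pi.mul_apply, this, norm_mul]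
  exact mul_le_mul_of_nonneg_right (hC x hx) (norm_nonneg _)

lemma tendstoL2loc_const (a : R3 → ℝ) : TendstoL2loc (fun _ => a) a := fun K _ => by
  simp

/-! ### Mollification -/

/-- A standard sequence of bump functions with supports shrinking to the origin. -/
def bump (n : ℕ) : ContDiffBump (0 : R3) :=
  ⟨(1 : ℝ) / 2 * (1 / ((n : ℝ) + 1)), 1 / ((n : ℝ) + 1), by positivity, by
    have : (0 : ℝ) < 1 / ((n : ℝ) + 1) := by positivity
    linarith⟩

/-- The mollification `ρₙ ⋆ u`. -/
def mollify (u : R3 → ℝ) (n : ℕ) : R3 → ℝ :=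
  (bump n).normed volume ⋆[ContinuousLinearMap.lsmul ℝ ℝ, volume] u

lemma mollify_apply (u : R3 → ℝ) (n : ℕ) (x : R3) :
    mollify u n x = ∫ t, (bump n).normed volume t * u (x - t) := rfl

lemma bump_rOut (n : ℕ) : (bump n).rOut = 1 / ((n : ℝ) + 1) := rfl

lemma tendsto_bump_rOut : Tendsto (fun n => (bump n).rOut) atTop (𝓝 0) :=
  tendsto_one_div_add_atTop_nhds_zero_nat

lemma bump_rOut_le_one (n : ℕ) : (bump n).rOut ≤ 1 := by
  rw [bump_rOut, div_le_one (by positivity)]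
  simp

lemma contDiff_mollify {u : R3 → ℝ} (hu : LocallyIntegrable u volume) (n : ℕ) :
    ContDiff ℝ ∞ (mollify u n) :=
  (bump n).hasCompactSupport_normed.contDiff_convolution_left _ (bump n).contDiff_normed hu

/-- Convergence at Lebesgue points. It needs the inner and outer radii of the bumps to stay
comparable; their ratio is fixed, whence `K = 2`. -/
lemma ae_tendsto_mollify {u : R3 → ℝ} (hu : LocallyIntegrable u volume) :
    ∀ᵐ x, Tendsto (fun n => mollify u n x) atTop (𝓝 (u x)) :=
  ContDiffBump.ae_convolution_tendsto_right_of_locallyIntegrable (K := 2) tendsto_bump_rOut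
    (Eventually.of_forall fun n => by
      change 1 / ((n : ℝ) + 1) ≤ 2 * (1 / 2 * (1 / ((n : ℝ) + 1)))
      linarith) hu

/-- The derivative falls on `ρ`, and `y ↦ ρ(x - y)` is an admissible test function. The sign from
differentiating in `y` cancels the sign in the definition of weak derivative. -/
lemma partialDeriv_mollify {u v : R3 → ℝ} {i : Fin 3} (h : HasWeakPartial i u v) (n : ℕ) :
    partialDeriv i (mollify u n) = mollify v n := by
  ext x
  set ρ : R3 → ℝ := (bump n).normed volume with hρ
  have hρs : ContDiff ℝ ∞ ρ := (bump n).contDiff_normed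
  have hρc : HasCompactSupport ρ := (bump n).hasCompactSupport_normed
  have hd := hρc.hasFDerivAt_convolution_left (ContinuousLinearMap.lsmul ℝ ℝ)
    (hρs.of_le (by simp)) h.locallyIntegrable x
  have h1 : partialDeriv i (mollify u n) x = ∫ t, partialDeriv i ρ t * u (x - t) := by
    change fderiv ℝ (ρ ⋆[ContinuousLinearMap.lsmul ℝ ℝ, volume] u) x _ = _
    rw [hd.fderiv]
    have hci : ConvolutionExistsAt (fderiv ℝ ρ) u x
        ((ContinuousLinearMap.lsmul ℝ ℝ).precompL R3) volume :=
      (hρc.fderiv ℝ).convolutionExists_left _ (hρs.continuous_fderiv (by simp))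
        h.locallyIntegrable x
    rw [convolution_def, ContinuousLinearMap.integral_apply hci]
    rfl
  have hψ : IsTestFunction (fun y => ρ (x - y)) :=
    ⟨hρs.comp (contDiff_const.sub contDiff_id),
      hρc.comp_homeomorph (Homeomorph.subLeft x)⟩
  have hψd : ∀ y, partialDeriv i (fun y => ρ (x - y)) y = - partialDeriv i ρ (x - y) := by
    intro y
    have := ((differentiable_of_smooth hρs (x - y)).hasFDerivAt.comp y
      ((hasFDerivAt_const x y).sub (hasFDerivAt_id y))).fderiv
    simp only [partialDeriv]
    change fderiv ℝ (ρ ∘ (fun y => x - y)) y _ = _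
    simpa using congrArg (fun L => L (EuclideanSpace.single i (1 : ℝ))) this
  rw [h1, mollify_apply, ← integral_sub_left_eq_self _ volume x,
    ← integral_sub_left_eq_self (fun t => ρ t * v (x - t)) volume x]
  have h2 := h.integral_eq _ hψ
  simp only [hψd, sub_sub_cancel, mul_neg, integral_neg] at h2 ⊢
  rw [neg_inj] at h2
  simpa [mul_comm] using h2

/-! ### Convergence of mollifications in `L²_loc` -/

lemma tendsto_eLpNorm_translate {g : R3 → ℝ} (hg : MemLp g 2 volume) :
    Tendsto (fun t : R3 => eLpNorm (fun x => g (x - t) - g x) 2 volume) (𝓝 0) (𝓝 0) := by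
  -- Translations are curried into a continuous family of maps, so that continuity in `L²` follows
  -- from that of composition with measure-preserving maps.
  let T : C(R3, C(R3, R3)) :=
    (ContinuousMap.mk (fun a : R3 × R3 ↦ a.2 - a.1) (by fun_prop)).curry
  have hT : ∀ t, MeasurePreserving (T t) volume volume := fun t =>
    measurePreserving_sub_right volume t
  have h0 : ∀ t, Lp.compMeasurePreserving (T t) (hT t) hg.toLp - hg.toLp
      = ((hg.comp_measurePreserving (hT t)).sub hg).toLp := fun t => by
    rw [Lp.toLp_compMeasurePreserving, MemLp.toLp_sub]
  have h := (tendsto_const_nhds (x := hg.toLp) (f := 𝓝 (0 : R3))).compMeasurePreservingLp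
    (g := fun t => T t) (g₀ := T 0) (T.continuous.tendsto 0) hT (hT 0) (by simp)
  have hz : Lp.compMeasurePreserving (T 0) (hT 0) hg.toLp = hg.toLp := by
    rw [Lp.toLp_compMeasurePreserving]
    congr 1
    ext x
    simp [T]
  rw [hz, tendsto_iff_edist_tendsto_0] at h
  refine h.congr fun t => ?_
  rw [edist_eq_enorm_sub, h0, Lp.enorm_toLp]
  rfl

/-- `ρ dt` is a probability measure, so the `L¹` norm in `t` is at most the `L²` norm; Tonelli then
exchanges the integrals, and only translations within the support of `ρ` contribute. -/
lemma eLpNorm_mollify_sub_le {g : R3 → ℝ} (hg : MemLp g 2 volume) (n : ℕ) {ε : ℝ≥0∞}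
    (hε : ∀ t : R3, ‖t‖ < (bump n).rOut → eLpNorm (fun x => g (x - t) - g x) 2 volume ≤ ε) :
    eLpNorm (mollify g n - g) 2 volume ≤ ε := by
  set ρ : R3 → ℝ := (bump n).normed volume with hρ
  have hρ0 : ∀ t, 0 ≤ ρ t := (bump n).nonneg_normed
  have hρm : Continuous ρ := (bump n).continuous_normed
  have hρc : HasCompactSupport ρ := (bump n).hasCompactSupport_normed
  have hρi : Integrable ρ volume := hρm.integrable_of_hasCompactSupport hρc
  let r : R3 → ℝ≥0∞ := fun t => ENNReal.ofReal (ρ t)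
  have hrm : Measurable r := hρm.measurable.ennreal_ofReal
  have hr1 : ∫⁻ t, r t = 1 := by
    rw [← ofReal_integral_eq_lintegral_ofReal hρi (Eventually.of_forall hρ0),
      (bump n).integral_normed, ENNReal.ofReal_one]
  let ν : Measure R3 := volume.withDensity r
  have : IsProbabilityMeasure ν := ⟨by simp [ν, hr1]⟩
  have hac : ν ≪ volume := withDensity_absolutelyContinuous _ _
  have hjoint : AEStronglyMeasurable (fun z : R3 × R3 => g (z.1 - z.2) - g z.1)
      (volume.prod volume) :=
    (hg.1.comp_quasiMeasurePreserving (quasiMeasurePreserving_sub volume volume)).sub hg.1.comp_fst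
  have hsec : ∀ x, AEStronglyMeasurable (fun t => g (x - t) - g x) ν := fun x =>
    ((hg.1.comp_quasiMeasurePreserving
      (quasiMeasurePreserving_sub_left volume x)).sub aestronglyMeasurable_const).mono_ac hac
  have hpt : ∀ x, ‖mollify g n x - g x‖ₑ ^ (2 : ℝ)
      ≤ ∫⁻ t, r t * ‖g (x - t) - g x‖ₑ ^ (2 : ℝ) := by
    intro x
    have hce : Integrable (fun t => ρ t * g (x - t)) volume :=
      hρc.convolutionExists_left (ContinuousLinearMap.lsmul ℝ ℝ) hρm
        (hg.locallyIntegrable (by simp)) x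
    have e1 : mollify g n x - g x = ∫ t, ρ t * (g (x - t) - g x) := by
      simp_rw [mul_sub]
      rw [integral_sub hce (hρi.mul_const _), integral_mul_const, (bump n).integral_normed,
        one_mul, mollify_apply]
    have e2 : ‖mollify g n x - g x‖ₑ ≤ eLpNorm (fun t => g (x - t) - g x) 1 ν := by
      rw [e1, eLpNorm_one_eq_lintegral_enorm,
        lintegral_withDensity_eq_lintegral_mul_non_measurable₀ _ hrm.aemeasurable
          (by simp [r])]
      refine (enorm_integral_le_lintegral_enorm _).trans (lintegral_mono fun t => ?_)
      simp [enorm_mul, r, Real.enorm_of_nonneg (hρ0 t)]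
    have e3 := e2.trans (eLpNorm_le_eLpNorm_of_exponent_le (p := 1) (q := 2) (by norm_num)
      (hsec x))
    calc ‖mollify g n x - g x‖ₑ ^ (2 : ℝ)
        ≤ eLpNorm (fun t => g (x - t) - g x) 2 ν ^ (2 : ℝ) := by gcongr
      _ = ∫⁻ t, ‖g (x - t) - g x‖ₑ ^ (2 : ℝ) ∂ν := by
          rw [eLpNorm_eq_lintegral_rpow_enorm_toReal (by simp) (by simp), ← ENNReal.rpow_mul]
          simp
      _ = _ := by
          rw [lintegral_withDensity_eq_lintegral_mul_non_measurable₀ _ hrm.aemeasurable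
            (by simp [r])]
          rfl
  have hsq : eLpNorm (mollify g n - g) 2 volume ^ (2 : ℝ) ≤ ε ^ (2 : ℝ) := by
    calc eLpNorm (mollify g n - g) 2 volume ^ (2 : ℝ)
        = ∫⁻ x, ‖mollify g n x - g x‖ₑ ^ (2 : ℝ) := by
          rw [eLpNorm_eq_lintegral_rpow_enorm_toReal (by simp) (by simp), ← ENNReal.rpow_mul]
          simp
      _ ≤ ∫⁻ x, ∫⁻ t, r t * ‖g (x - t) - g x‖ₑ ^ (2 : ℝ) := lintegral_mono hpt
      _ = ∫⁻ t, ∫⁻ x, r t * ‖g (x - t) - g x‖ₑ ^ (2 : ℝ) := by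
          refine lintegral_lintegral_swap ?_
          exact (hrm.comp measurable_snd).aemeasurable.mul (hjoint.enorm.pow_const _)
      _ = ∫⁻ t, r t * eLpNorm (fun x => g (x - t) - g x) 2 volume ^ (2 : ℝ) := by
          refine lintegral_congr fun t => ?_
          rw [lintegral_const_mul' _ _ (by simp [r]),
            eLpNorm_eq_lintegral_rpow_enorm_toReal (by simp) (by simp), ← ENNReal.rpow_mul]
          simp
      _ ≤ ∫⁻ t, r t * ε ^ (2 : ℝ) := by
          refine lintegral_mono fun t => ?_
          by_cases ht : ‖t‖ < (bump n).rOut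
          · dsimp only
            gcongr
            exact hε t ht
          · have : ρ t = 0 := by
              by_contra h0
              have : t ∈ Function.support ρ := h0
              rw [hρ, (bump n).support_normed_eq] at this
              exact ht (by simpa using this)
            simp [r, this]
      _ = ε ^ (2 : ℝ) := by
          rw [lintegral_mul_const _ hrm, hr1, one_mul]
  exact (ENNReal.rpow_le_rpow_iff (by norm_num)).1 hsq

lemma tendsto_eLpNorm_mollify {g : R3 → ℝ} (hg : MemLp g 2 volume) :
    Tendsto (fun n => eLpNorm (mollify g n - g) 2 volume) atTop (𝓝 0) := by
  rw [ENNReal.tendsto_nhds_zero]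
  intro ε hε
  have h := (ENNReal.tendsto_nhds_zero.1 (tendsto_eLpNorm_translate hg)) ε hε
  obtain ⟨δ, hδ, hd⟩ := Metric.eventually_nhds_iff.1 h
  filter_upwards [tendsto_bump_rOut.eventually (gt_mem_nhds hδ)] with n hn
  refine eLpNorm_mollify_sub_le hg n fun t ht => hd ?_
  rw [dist_zero_right]
  exact ht.trans hn

/-- All bumps live in the unit ball, so on `K` the mollification only sees `g` on a ball larger by
one. Truncating `g` there reduces to global `L²`. -/
lemma tendstoL2loc_mollify {g : R3 → ℝ} (hg : MemL2loc g) : TendstoL2loc (mollify g) g := by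
  intro K hK
  obtain ⟨R, hR⟩ := hK.isBounded.subset_closedBall (0 : R3)
  set B := Metric.closedBall (0 : R3) (R + 1) with hB
  have hBm : MeasurableSet B := measurableSet_closedBall
  have hg' : MemLp (B.indicator g) 2 volume :=
    (memLp_indicator_iff_restrict hBm).2 (hg B (isCompact_closedBall _ _))
  refine tendsto_of_tendsto_of_tendsto_of_le_of_le tendsto_const_nhds
    (tendsto_eLpNorm_mollify hg') (fun _ => zero_le) (fun n => ?_)
  refine le_trans (le_of_eq ?_) (eLpNorm_restrict_le _ _ _ K)
  refine eLpNorm_congr_ae ?_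
  filter_upwards [ae_restrict_mem hK.measurableSet] with x hx
  have hxR : ‖x‖ ≤ R := by simpa using hR hx
  have e1 : B.indicator g x = g x := by
    refine Set.indicator_of_mem ?_ _
    simp only [hB, mem_closedBall_zero_iff]
    linarith
  have e2 : mollify (B.indicator g) n x = mollify g n x := by
    rw [mollify_apply, mollify_apply]
    refine integral_congr_ae (Eventually.of_forall fun t => ?_)
    dsimp only
    by_cases ht : t ∈ Function.support ((bump n).normed (volume : Measure R3))
    · have ht' : ‖t‖ < 1 := by
        rw [(bump n).support_normed_eq] at ht
        have : ‖t‖ < (bump n).rOut := by simpa using ht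
        exact this.trans_le (bump_rOut_le_one n)
      rw [Set.indicator_of_mem]
      simp only [hB, mem_closedBall_zero_iff]
      linarith [norm_sub_le x t]
    · rw [Function.notMem_support.1 ht, zero_mul, zero_mul]
  simp [e1, e2]

/-! ### The embedding `H²_loc ⊆ L^∞_loc` -/

section Fourier

open FourierTransform SchwartzMap Laplacian

lemma fourier_laplacian_apply (f : 𝓢(R3, ℂ)) (ξ : R3) :
    𝓕 (Δ f) ξ = -((2 * Real.pi) ^ 2 * ‖ξ‖ ^ 2 : ℝ) * 𝓕 f ξ := by
  rw [laplacian_eq_fourierMultiplierCLM, fourierMultiplierCLM_apply,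
    FourierTransform.fourier_smul, FourierTransform.fourier_fourierInv_eq]
  have h : (fun x : R3 => ‖x‖ ^ 2).HasTemperateGrowth := by fun_prop
  change (-(2 * Real.pi) ^ 2) • (smulLeftCLM ℂ (fun x : R3 => ‖x‖ ^ 2) (𝓕 f)) ξ = _
  rw [smulLeftCLM_apply_apply h]
  simp only [Complex.real_smul]
  push_cast
  ring

lemma norm_le_integral_norm_fourier (f : 𝓢(R3, ℂ)) (x : R3) : ‖f x‖ ≤ ∫ ξ, ‖𝓕 f ξ‖ := by
  have h : f x = 𝓕⁻ (𝓕 f) x := by rw [FourierTransform.fourierInv_fourier_eq]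
  rw [h, fourierInv_coe, Real.fourierInv_eq]
  refine (norm_integral_le_integral_norm _).trans (le_of_eq ?_)
  simp

/-- A quantitative form of the embedding `H²(ℝ³) ⊆ L^∞(ℝ³)`. -/
lemma exists_forall_schwartz_norm_le : ∃ C : ℝ, ∀ (f : 𝓢(R3, ℂ)) (x : R3),
    ‖f x‖ ≤ C + (∫ y, ‖f y‖ ^ 2) + ∫ y, ‖(Δ f) y‖ ^ 2 := by
  -- The decay exponent `4` exceeds the dimension `3`; this is where low dimension enters the
  -- embedding.
  have hint : Integrable (fun ξ : R3 => ((1 : ℝ) + ‖ξ‖ ^ 2) ^ (-(4 : ℝ) / 2)) volume :=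
    integrable_rpow_neg_one_add_norm_sq (by simp; norm_num)
  refine ⟨(1 / 2) * ∫ ξ : R3, ((1 : ℝ) + ‖ξ‖ ^ 2) ^ (-(4 : ℝ) / 2), fun f x => ?_⟩
  have sqi : ∀ h : 𝓢(R3, ℂ), Integrable (fun y => ‖h y‖ ^ 2) volume := fun h =>
    (memLp_two_iff_integrable_sq_norm (h.continuous.aestronglyMeasurable)).1 (h.memLp 2 _)
  -- This `c` undoes the normalization of the Fourier transform, so that `f - c Δf` has symbol
  -- exactly `1 + |ξ|²`.
  set c : ℝ := ((2 * Real.pi) ^ 2)⁻¹ with hc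
  have hpi : (1 : ℝ) ≤ (2 * Real.pi) ^ 2 := by nlinarith [Real.pi_gt_three]
  have hc1 : c ≤ 1 := inv_le_one_of_one_le₀ hpi
  have hc0 : 0 ≤ c := by positivity
  set g : 𝓢(R3, ℂ) := f - c • Δ f with hg
  have hFg : ∀ ξ, 𝓕 g ξ = ((1 + ‖ξ‖ ^ 2 : ℝ) : ℂ) * 𝓕 f ξ := by
    intro ξ
    have : 𝓕 g = 𝓕 f - c • 𝓕 (Δ f) := by
      rw [hg, sub_eq_add_neg, FourierTransform.fourier_add, ← neg_smul,
        FourierTransform.fourier_smul, neg_smul, ← sub_eq_add_neg]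
    rw [this, _root_.sub_apply, _root_.smul_apply, fourier_laplacian_apply]
    simp only [Complex.real_smul]
    have hne : ((2 * Real.pi) ^ 2 : ℂ) ≠ 0 := by
      have := Real.pi_ne_zero
      simp [this]
    have : (c : ℂ) = ((2 * Real.pi) ^ 2 : ℂ)⁻¹ := by rw [hc]; push_cast; rfl
    rw [this]
    push_cast
    field_simp
    ring
  -- Arithmetic-geometric mean on `(1+|ξ|²)⁻¹ · |ĝ|`. This inhomogeneous bound is enough, since only
  -- uniform boundedness of sequences is wanted.
  have hpt : ∀ ξ, ‖𝓕 f ξ‖ ≤ (1 / 2) * ((1 : ℝ) + ‖ξ‖ ^ 2) ^ (-(4 : ℝ) / 2)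
      + (1 / 2) * ‖𝓕 g ξ‖ ^ 2 := by
    intro ξ
    have hpos : (0 : ℝ) < 1 + ‖ξ‖ ^ 2 := by positivity
    have e1 : ((1 : ℝ) + ‖ξ‖ ^ 2) ^ (-(4 : ℝ) / 2) = ((1 + ‖ξ‖ ^ 2)⁻¹) ^ 2 := by
      rw [show (-(4 : ℝ) / 2) = -(2 : ℕ) by norm_num, Real.rpow_neg hpos.le, Real.rpow_natCast,
        inv_pow]
    have e2 : ‖𝓕 f ξ‖ = (1 + ‖ξ‖ ^ 2)⁻¹ * ‖𝓕 g ξ‖ := by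
      rw [hFg, norm_mul, Complex.norm_real, Real.norm_of_nonneg hpos.le]
      field_simp
    rw [e1, e2]
    nlinarith [sq_nonneg ((1 + ‖ξ‖ ^ 2)⁻¹ - ‖𝓕 g ξ‖)]
  have hI1 : Integrable (fun ξ => (1 / 2) * ((1 : ℝ) + ‖ξ‖ ^ 2) ^ (-(4 : ℝ) / 2)) volume :=
    hint.const_mul _
  have hI2 : Integrable (fun ξ => (1 / 2) * ‖𝓕 g ξ‖ ^ 2) volume := (sqi (𝓕 g)).const_mul _
  have hg2 : ∫ y, ‖g y‖ ^ 2 ≤ ∫ y, (2 * ‖f y‖ ^ 2 + 2 * ‖(Δ f) y‖ ^ 2) := by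
    refine integral_mono (sqi g) (((sqi f).const_mul 2).add ((sqi (Δ f)).const_mul 2))
      (fun y => ?_)
    have h1 : ‖g y‖ ≤ ‖f y‖ + ‖(Δ f) y‖ := by
      rw [hg, _root_.sub_apply, _root_.smul_apply]
      refine (norm_sub_le _ _).trans ?_
      rw [norm_smul, Real.norm_of_nonneg hc0]
      have := mul_le_mul_of_nonneg_right hc1 (norm_nonneg ((Δ f) y))
      linarith
    have h2 : ‖g y‖ ^ 2 ≤ (‖f y‖ + ‖(Δ f) y‖) ^ 2 := by gcongr
    dsimp only
    nlinarith [sq_nonneg (‖f y‖ - ‖(Δ f) y‖)]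
  rw [integral_add ((sqi f).const_mul 2) ((sqi (Δ f)).const_mul 2), integral_const_mul,
    integral_const_mul] at hg2
  calc ‖f x‖ ≤ ∫ ξ, ‖𝓕 f ξ‖ := norm_le_integral_norm_fourier f x
    _ ≤ ∫ ξ, ((1 / 2) * ((1 : ℝ) + ‖ξ‖ ^ 2) ^ (-(4 : ℝ) / 2) + (1 / 2) * ‖𝓕 g ξ‖ ^ 2) :=
        integral_mono ((𝓕 f).integrable.norm) (hI1.add hI2) hpt
    _ = (1 / 2) * (∫ ξ : R3, ((1 : ℝ) + ‖ξ‖ ^ 2) ^ (-(4 : ℝ) / 2)) + (1 / 2) * ∫ y, ‖g y‖ ^ 2 := by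
        rw [integral_add hI1 hI2, integral_const_mul, integral_const_mul,
          integral_norm_sq_fourier]
    _ ≤ _ := by linarith

end Fourier

/-- The classical Laplacian. -/
def lap (f : R3 → ℝ) (x : R3) : ℝ := ∑ i, partialDeriv i (partialDeriv i f) x

lemma exists_forall_abs_le : ∃ C : ℝ, ∀ v : R3 → ℝ, IsTestFunction v → ∀ x,
    |v x| ≤ C + (∫ y, v y ^ 2) + ∫ y, lap v y ^ 2 := by
  obtain ⟨C, hC⟩ := exists_forall_schwartz_norm_le
  refine ⟨C, fun v hv x => ?_⟩
  have hc : ∀ {h : R3 → ℝ}, IsTestFunction h → HasCompactSupport (fun x => (h x : ℂ)) :=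
    fun {h} hh => hh.compact.comp_left (g := fun t : ℝ => (t : ℂ)) (by simp)
  have hs : ∀ {h : R3 → ℝ}, IsTestFunction h → ContDiff ℝ ∞ (fun x => (h x : ℂ)) :=
    fun {h} hh => Complex.ofRealCLM.contDiff.comp hh.smooth
  let F : ∀ h : R3 → ℝ, IsTestFunction h → SchwartzMap R3 ℂ := fun h hh =>
    (hc hh).toSchwartzMap (hs hh)
  have hFd : ∀ (h : R3 → ℝ) (hh : IsTestFunction h) (i : Fin 3),
      LineDeriv.lineDerivOp (EuclideanSpace.single i (1 : ℝ)) (F h hh)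
        = F (partialDeriv i h) (hh.pderiv i) := by
    intro h hh i
    ext y
    rw [SchwartzMap.lineDerivOp_apply_eq_fderiv]
    change fderiv ℝ (fun x => (h x : ℂ)) y _ = ((partialDeriv i h y : ℝ) : ℂ)
    have := (Complex.ofRealCLM.hasFDerivAt.comp y
      (differentiable_of_smooth hh.smooth y).hasFDerivAt).fderiv
    change fderiv ℝ (Complex.ofRealCLM ∘ h) y _ = _
    rw [this]
    rfl
  have hlap : ∀ y, (Laplacian.laplacian (F v hv)) y = ((lap v y : ℝ) : ℂ) := by
    intro y
    rw [SchwartzMap.laplacian_eq_sum (EuclideanSpace.basisFun (Fin 3) ℝ)]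
    simp only [EuclideanSpace.basisFun_apply, hFd, lap]
    rw [_root_.sum_apply]
    push_cast
    rfl
  have h := hC (F v hv) x
  simp only [hlap] at h
  have e : ∀ y, F v hv y = ((v y : ℝ) : ℂ) := fun y => rfl
  simpa only [e, Complex.norm_real, Real.norm_eq_abs, sq_abs] using h

lemma TendstoL2loc.add {a b : ℕ → R3 → ℝ} {a₀ b₀ : R3 → ℝ} (hca : TendstoL2loc a a₀)
    (hcb : TendstoL2loc b b₀) (ha : ∀ n, MemL2loc (a n)) (hb : ∀ n, MemL2loc (b n))
    (ha₀ : MemL2loc a₀) (hb₀ : MemL2loc b₀) :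
    TendstoL2loc (fun n x => a n x + b n x) (fun x => a₀ x + b₀ x) := by
  intro K hK
  have h := (hca K hK).add (hcb K hK)
  rw [add_zero] at h
  refine tendsto_of_tendsto_of_tendsto_of_le_of_le tendsto_const_nhds h
    (fun _ => zero_le) (fun n => ?_)
  have e : ((fun x => a n x + b n x) - fun x => a₀ x + b₀ x) = (a n - a₀) + (b n - b₀) := by
    ext x; simp; ring
  dsimp only
  rw [e]
  exact eLpNorm_add_le ((ha n K hK).sub (ha₀ K hK)).1 ((hb n K hK).sub (hb₀ K hK)).1 (by norm_num)

lemma TendstoL2loc.mul_continuous {a : ℕ → R3 → ℝ} {a₀ θ : R3 → ℝ} (hca : TendstoL2loc a a₀)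
    (hθ : Continuous θ) : TendstoL2loc (fun n x => θ x * a n x) (fun x => θ x * a₀ x) := by
  intro K hK
  obtain ⟨C, hC⟩ := hK.exists_bound_of_continuousOn hθ.continuousOn
  have h : Tendsto (fun n => ENNReal.ofReal C * eLpNorm (a n - a₀) 2 (volume.restrict K)) atTop
      (𝓝 (ENNReal.ofReal C * 0)) :=
    ENNReal.Tendsto.const_mul (hca K hK) (Or.inr ENNReal.ofReal_ne_top)
  rw [mul_zero] at h
  refine tendsto_of_tendsto_of_tendsto_of_le_of_le tendsto_const_nhds h
    (fun _ => zero_le) (fun n => ?_)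
  refine eLpNorm_le_mul_eLpNorm_of_ae_le_mul ?_ 2
  filter_upwards [ae_restrict_mem hK.measurableSet] with x hx
  simp only [Pi.sub_apply, ← mul_sub, norm_mul]
  exact mul_le_mul_of_nonneg_right (hC x hx) (norm_nonneg _)

lemma TendstoL2loc.exists_forall_setIntegral_sq_le {a : ℕ → R3 → ℝ} {a₀ : R3 → ℝ}
    (hca : TendstoL2loc a a₀) (ha : ∀ n, MemL2loc (a n)) (ha₀ : MemL2loc a₀) {K : Set R3}
    (hK : IsCompact K) : ∃ C, ∀ n, ∫ x in K, a n x ^ 2 ≤ C := by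
  have h1 := tendsto_eLpNorm_one_mul (fun n => ha n K hK) (fun n => ha n K hK) (ha₀ K hK)
    (ha₀ K hK) (hca K hK) (hca K hK)
  have h2 : Tendsto (fun n => ∫ x in K, (a n * a n) x) atTop (𝓝 (∫ x in K, (a₀ * a₀) x)) :=
    tendsto_integral_of_L1' _ (ha₀.integrableOn_mul ha₀ hK).1
      (Eventually.of_forall fun n => (ha n).integrableOn_mul (ha n) hK) h1
  obtain ⟨C, hC⟩ := h2.bddAbove_range
  refine ⟨C, fun n => ?_⟩
  simpa [sq] using hC ⟨n, rfl⟩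

lemma lap_mul {f g : R3 → ℝ} (hf : ContDiff ℝ ∞ f) (hg : ContDiff ℝ ∞ g) (x : R3) :
    lap (fun x => f x * g x) x = ∑ i, (partialDeriv i (partialDeriv i f) x * g x
      + 2 * partialDeriv i f x * partialDeriv i g x
      + f x * partialDeriv i (partialDeriv i g) x) := by
  refine Finset.sum_congr rfl fun i _ => ?_
  have h : partialDeriv i (fun x => f x * g x)
      = fun x => partialDeriv i f x * g x + f x * partialDeriv i g x :=
    funext fun x => partialDeriv_mul hf hg i x
  have hf' := contDiff_partialDeriv hf i
  have hg' := contDiff_partialDeriv hg i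
  rw [h, partialDeriv_add (hf'.mul hg) (hf.mul hg'), partialDeriv_mul hf' hg,
    partialDeriv_mul hf hg']
  ring

lemma exists_testFunction_eq_one_on {K : Set R3} (hK : IsCompact K) :
    ∃ χ : R3 → ℝ, IsTestFunction χ ∧ ∀ x ∈ K, χ x = 1 := by
  obtain ⟨R, hR⟩ := hK.isBounded.subset_closedBall (0 : R3)
  let f : ContDiffBump (0 : R3) := ⟨max R 1, max R 1 + 1, by positivity, by linarith⟩
  refine ⟨f, ⟨f.contDiff, f.hasCompactSupport⟩, fun x hx => f.one_of_mem_closedBall ?_⟩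
  exact Metric.closedBall_subset_closedBall (le_max_left _ _) (hR hx)

/-- Smooth functions that converge in `H²_loc` are uniformly bounded on compact sets. -/
lemma exists_forall_abs_le_of_tendstoL2loc {v : ℕ → R3 → ℝ} {u : R3 → ℝ} {G H : Fin 3 → R3 → ℝ}
    (hv : ∀ n, ContDiff ℝ ∞ (v n)) (hu : MemL2loc u) (hG : ∀ i, MemL2loc (G i))
    (hH : ∀ i, MemL2loc (H i)) (h0 : TendstoL2loc v u)
    (h1 : ∀ i, TendstoL2loc (fun n => partialDeriv i (v n)) (G i))
    (h2 : ∀ i, TendstoL2loc (fun n => partialDeriv i (partialDeriv i (v n))) (H i))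
    {K : Set R3} (hK : IsCompact K) : ∃ M, ∀ n, ∀ x ∈ K, |v n x| ≤ M := by
  obtain ⟨χ, hχ, hχ1⟩ := exists_testFunction_eq_one_on hK
  obtain ⟨C, hC⟩ := exists_forall_abs_le
  have hχ' := fun i => hχ.pderiv i
  have hχ'' := fun i => (hχ.pderiv i).pderiv i
  have hv' := fun n i => contDiff_partialDeriv (hv n) i
  have hv'' := fun n i => contDiff_partialDeriv (hv' n i) i
  -- By the Leibniz rule the Laplacian of `χ v` involves only `v`, its gradient and its pure second
  -- derivatives, all of which converge in `L²_loc`; a convergent sequence has bounded norms.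
  have key : ∃ D, MemL2loc D ∧ TendstoL2loc (fun n => lap (fun x => χ x * v n x)) D := by
    let T : Fin 3 → ℕ → R3 → ℝ := fun i n x => (partialDeriv i (partialDeriv i χ) x * v n x
      + 2 * partialDeriv i χ x * partialDeriv i (v n) x)
      + χ x * partialDeriv i (partialDeriv i (v n)) x
    let D : Fin 3 → R3 → ℝ := fun i x => (partialDeriv i (partialDeriv i χ) x * u x
      + 2 * partialDeriv i χ x * G i x) + χ x * H i x
    have c1 := fun i => (hχ'' i).smooth.continuous
    have c2 : ∀ i, Continuous fun x => 2 * partialDeriv i χ x := fun i =>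
      continuous_const.mul (hχ' i).smooth.continuous
    have c3 := hχ.smooth.continuous
    have m1 := fun i => hu.mul_continuous (c1 i)
    have m2 := fun i => (hG i).mul_continuous (c2 i)
    have m3 := fun i => (hH i).mul_continuous c3
    have n1 := fun i n => (hv n).continuous.memL2loc.mul_continuous (c1 i)
    have n2 := fun i n => (hv' n i).continuous.memL2loc.mul_continuous (c2 i)
    have n3 := fun i n => (hv'' n i).continuous.memL2loc.mul_continuous c3
    have hD : ∀ i, MemL2loc (D i) := fun i => ((m1 i).add (m2 i)).add (m3 i)
    have hTm : ∀ i n, MemL2loc (T i n) := fun i n => ((n1 i n).add (n2 i n)).add (n3 i n)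
    have hT : ∀ i, TendstoL2loc (T i) (D i) := fun i =>
      ((h0.mul_continuous (c1 i)).add ((h1 i).mul_continuous (c2 i)) (n1 i) (n2 i) (m1 i)
        (m2 i)).add ((h2 i).mul_continuous c3) (fun n => (n1 i n).add (n2 i n)) (n3 i)
        ((m1 i).add (m2 i)) (m3 i)
    refine ⟨fun x => D 0 x + D 1 x + D 2 x, ((hD 0).add (hD 1)).add (hD 2), ?_⟩
    have hlap : (fun n => lap (fun x => χ x * v n x))
        = fun n x => T 0 n x + T 1 n x + T 2 n x := by
      ext n x
      rw [lap_mul hχ.smooth (hv n), Fin.sum_univ_three]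
    rw [hlap]
    exact ((hT 0).add (hT 1) (hTm 0) (hTm 1) (hD 0) (hD 1)).add (hT 2)
      (fun n => (hTm 0 n).add (hTm 1 n)) (hTm 2) ((hD 0).add (hD 1)) (hD 2)
  obtain ⟨D, hD, hDt⟩ := key
  have hw : ∀ n, IsTestFunction (fun x => χ x * v n x) := fun n => hχ.mul_right (hv n)
  have hlc : ∀ n, Continuous (lap (fun x => χ x * v n x)) := fun n =>
    continuous_finsetSum _ fun i _ => (((hw n).pderiv i).pderiv i).smooth.continuous
  obtain ⟨C1, hC1⟩ := (h0.mul_continuous hχ.smooth.continuous).exists_forall_setIntegral_sq_le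
    (fun n => (hw n).smooth.continuous.memL2loc) (hu.mul_continuous hχ.smooth.continuous)
    hχ.compact
  obtain ⟨C2, hC2⟩ := hDt.exists_forall_setIntegral_sq_le (fun n => (hlc n).memL2loc) hD
    hχ.compact
  have hsupp : ∀ n x, x ∉ tsupport χ → lap (fun x => χ x * v n x) x = 0 := by
    intro n x hx
    refine Finset.sum_eq_zero fun i _ => ?_
    have : ∀ f : R3 → ℝ, x ∉ tsupport f → x ∉ tsupport (partialDeriv i f) := by
      intro f hf hx'
      exact hf (tsupport_fderiv_apply_subset ℝ _ hx')
    refine image_eq_zero_of_notMem_tsupport (this _ (this _ fun h => hx ?_))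
    exact tsupport_mul_subset_left (f := χ) (g := v n) h
  refine ⟨C + C1 + C2, fun n x hx => ?_⟩
  have h := hC _ (hw n) x
  rw [hχ1 x hx, one_mul] at h
  have e1 : ∫ y, (χ y * v n y) ^ 2 = ∫ y in tsupport χ, (χ y * v n y) ^ 2 := by
    rw [setIntegral_eq_integral_of_forall_compl_eq_zero]
    intro y hy
    simp [image_eq_zero_of_notMem_tsupport hy]
  have e2 : ∫ y, lap (fun x => χ x * v n x) y ^ 2
      = ∫ y in tsupport χ, lap (fun x => χ x * v n x) y ^ 2 := by
    rw [setIntegral_eq_integral_of_forall_compl_eq_zero]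
    intro y hy
    simp [hsupp n y hy]
  rw [e1, e2] at h
  linarith [hC1 n, hC2 n]

/-! ### Weak derivatives -/

/-- The hypotheses `MemE`, `MemH2loc` and `IsWeakSolution` each supply their own weak gradient; this
identifies them. -/
lemma HasWeakPartial.ae_eq {i : Fin 3} {u v v' : R3 → ℝ} (h : HasWeakPartial i u v)
    (h' : HasWeakPartial i u v') : v =ᵐ[volume] v' := by
  refine ae_eq_of_integral_contDiff_smul_eq h.locallyIntegrable_deriv h'.locallyIntegrable_deriv
    fun ψ hψ hψc => ?_
  have h1 := h.integral_eq ψ ⟨hψ, hψc⟩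
  have h2 := h'.integral_eq ψ ⟨hψ, hψc⟩
  simp only [smul_eq_mul, mul_comm (ψ _)]
  linarith

/-- The weak Leibniz rule for functions with weak derivatives in `L²_loc`. -/
lemma HasWeakPartial.leibniz {i : Fin 3} {a b a' b' θ : R3 → ℝ} (ha : HasWeakPartial i a a')
    (hb : HasWeakPartial i b b') (hma : MemL2loc a) (hma' : MemL2loc a') (hmb : MemL2loc b)
    (hmb' : MemL2loc b') (hθ : IsTestFunction θ) :
    (∫ x, θ x * a' x * b x) + ∫ x, θ x * a x * b' x = - ∫ x, partialDeriv i θ x * a x * b x := by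
  -- Only `a` is mollified: `θ` times a smooth function is a test function for the weak derivative
  -- of `b`.
  have hs := fun n => contDiff_mollify ha.locallyIntegrable n
  have hs' := fun n => contDiff_mollify ha.locallyIntegrable_deriv n
  have hm := fun n => (hs n).continuous.memL2loc
  have hm' := fun n => (hs' n).continuous.memL2loc
  have hθ' := hθ.pderiv i
  have t1 := tendsto_integral_mul_mul hm' (fun _ => hmb) hma' hmb (tendstoL2loc_mollify hma')
    (tendstoL2loc_const b) hθ.smooth.continuous hθ.compact
  have t2 := tendsto_integral_mul_mul hm (fun _ => hmb') hma hmb' (tendstoL2loc_mollify hma)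
    (tendstoL2loc_const b') hθ.smooth.continuous hθ.compact
  have t3 := tendsto_integral_mul_mul hm (fun _ => hmb) hma hmb (tendstoL2loc_mollify hma)
    (tendstoL2loc_const b) hθ'.smooth.continuous hθ'.compact
  refine tendsto_nhds_unique (t1.add t2) (t3.neg.congr fun n => ?_)
  have h := hb.integral_eq _ (hθ.mul_right (hs n))
  have e1 : ∀ x, b x * partialDeriv i (fun x => θ x * mollify a n x) x
      = partialDeriv i θ x * mollify a n x * b x + θ x * mollify a' n x * b x := by
    intro x
    rw [partialDeriv_mul hθ.smooth (hs n), partialDeriv_mollify ha]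
    ring
  simp only [e1] at h
  rw [integral_add ((hm n).integrable_mul_mul hmb hθ'.smooth.continuous hθ'.compact)
    ((hm' n).integrable_mul_mul hmb hθ.smooth.continuous hθ.compact)] at h
  have e2 : ∫ x, b' x * (θ x * mollify a n x) = ∫ x, θ x * mollify a n x * b' x := by
    simp only [mul_comm (b' _)]
  rw [e2] at h
  linarith

/-- `u ∈ H²_loc(ℝ³)` with weak gradient `G` and weak Hessian `H`. -/
structure IsH2loc (u : R3 → ℝ) (G : Fin 3 → R3 → ℝ) (H : Fin 3 → Fin 3 → R3 → ℝ) : Prop where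
  mem : MemL2loc u
  grad : HasWeakGradient u G
  mem_grad : ∀ i, MemL2loc (G i)
  hess : ∀ i, HasWeakGradient (G i) (H i)
  mem_hess : ∀ i j, MemL2loc (H i j)

section

variable {u : R3 → ℝ} {G : Fin 3 → R3 → ℝ} {H : Fin 3 → Fin 3 → R3 → ℝ}

lemma IsH2loc.hess_symm (h : IsH2loc u G H) (i j : Fin 3) : H i j =ᵐ[volume] H j i := by
  refine ae_eq_of_integral_contDiff_smul_eq (h.mem_hess i j).locallyIntegrable
    (h.mem_hess j i).locallyIntegrable fun ψ hψ hψc => ?_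
  have hψ' : IsTestFunction ψ := ⟨hψ, hψc⟩
  have h1 := (h.hess i j).integral_eq ψ hψ'
  have h2 := (h.hess j i).integral_eq ψ hψ'
  have h3 := (h.grad i).integral_eq _ (hψ'.pderiv j)
  have h4 := (h.grad j).integral_eq _ (hψ'.pderiv i)
  simp only [partialDeriv_comm hψ i j] at h3
  simp only [smul_eq_mul, mul_comm (ψ _)]
  linarith

/-- The Rellich-type identity for the second derivatives. -/
lemma IsH2loc.integral_hess_mul_grad (h : IsH2loc u G H) {θ : R3 → ℝ} (hθ : IsTestFunction θ)
    (i j : Fin 3) : ∫ x, θ x * H j j x * G i x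
      = (1 / 2) * (∫ x, partialDeriv i θ x * G j x * G j x)
        - ∫ x, partialDeriv j θ x * G j x * G i x := by
  -- `h1` moves one derivative off `∂ⱼ∂ⱼu`, leaving `∂ⱼu ∂ⱼ∂ᵢu`; by symmetry of the Hessian this is
  -- half of `∂ᵢ(∂ⱼu)²`, which `h2` integrates.
  have h1 := (h.hess j j).leibniz (h.hess i j) (h.mem_grad j) (h.mem_hess j j) (h.mem_grad i)
    (h.mem_hess i j) hθ
  have h2 := (h.hess j i).leibniz (h.hess j i) (h.mem_grad j) (h.mem_hess j i) (h.mem_grad j)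
    (h.mem_hess j i) hθ
  have h3 : ∫ x, θ x * G j x * H i j x = ∫ x, θ x * G j x * H j i x := by
    refine integral_congr_ae ?_
    filter_upwards [h.hess_symm i j] with x hx
    rw [hx]
  have h4 : ∫ x, θ x * H j i x * G j x = ∫ x, θ x * G j x * H j i x := by
    refine integral_congr_ae (Eventually.of_forall fun x => ?_)
    dsimp only
    ring
  linarith

lemma IsH2loc.integral_hess_mul (h : IsH2loc u G H) {θ : R3 → ℝ} (hθ : IsTestFunction θ)
    (j : Fin 3) : ∫ x, θ x * H j j x * u x
      = - (∫ x, partialDeriv j θ x * G j x * u x) - ∫ x, θ x * G j x * G j x := by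
  have h1 := (h.hess j j).leibniz (h.grad j) (h.mem_grad j) (h.mem_hess j j) h.mem
    (h.mem_grad j) hθ
  linarith

lemma IsH2loc.integral_sq (h : IsH2loc u G H) {θ : R3 → ℝ} (hθ : IsTestFunction θ)
    (i : Fin 3) : 2 * ∫ x, θ x * u x * G i x = - ∫ x, partialDeriv i θ x * u x * u x := by
  have h1 := (h.grad i).leibniz (h.grad i) h.mem (h.mem_grad i) h.mem (h.mem_grad i) hθ
  have h2 : ∫ x, θ x * G i x * u x = ∫ x, θ x * u x * G i x := by
    refine integral_congr_ae (Eventually.of_forall fun x => ?_)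
    dsimp only
    ring
  linarith

/-! ### Local boundedness and continuous functions of `u`. -/

lemma IsH2loc.exists_forall_mollify_abs_le (h : IsH2loc u G H) {K : Set R3} (hK : IsCompact K) :
    ∃ M, ∀ n, ∀ x ∈ K, |mollify u n x| ≤ M := by
  refine exists_forall_abs_le_of_tendstoL2loc (H := fun i => H i i)
    (fun n => contDiff_mollify (h.mem.locallyIntegrable) n)
    h.mem h.mem_grad (fun i => h.mem_hess i i) (tendstoL2loc_mollify h.mem) (fun i => ?_)
    (fun i => ?_) hK
  · simp only [partialDeriv_mollify (h.grad i)]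
    exact tendstoL2loc_mollify (h.mem_grad i)
  · simp only [partialDeriv_mollify (h.grad i), partialDeriv_mollify (h.hess i i)]
    exact tendstoL2loc_mollify (h.mem_hess i i)

lemma IsH2loc.exists_ae_abs_le (h : IsH2loc u G H) {K : Set R3} (hK : IsCompact K) :
    ∃ M, ∀ᵐ x ∂(volume.restrict K), |u x| ≤ M := by
  obtain ⟨M, hM⟩ := h.exists_forall_mollify_abs_le hK
  refine ⟨M, ?_⟩
  filter_upwards [ae_restrict_mem hK.measurableSet,
    ae_restrict_of_ae (ae_tendsto_mollify h.mem.locallyIntegrable)] with x hx ht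
  exact le_of_tendsto ht.abs (Eventually.of_forall fun n => hM n x hx)

lemma exists_abs_comp_le {g : ℝ → ℝ} (hg : Continuous g) (M : ℝ) :
    ∃ C, ∀ t, |t| ≤ M → |g t| ≤ C := by
  obtain ⟨C, hC⟩ := (isCompact_Icc (a := -M) (b := M)).exists_bound_of_continuousOn hg.continuousOn
  exact ⟨C, fun t ht => hC t (abs_le.1 ht)⟩

lemma IsH2loc.memL2loc_comp (h : IsH2loc u G H) {g : ℝ → ℝ} (hg : Continuous g) :
    MemL2loc (fun x => g (u x)) := by
  intro K hK
  have : IsFiniteMeasure (volume.restrict K) := ⟨by simpa using hK.measure_lt_top⟩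
  obtain ⟨M, hM⟩ := h.exists_ae_abs_le hK
  obtain ⟨C, hC⟩ := exists_abs_comp_le hg M
  refine MemLp.of_bound (hg.comp_aestronglyMeasurable (h.mem K hK).1) C ?_
  filter_upwards [hM] with x hx using hC _ hx

/-- Dominated convergence on a set of finite measure. The mollifications are uniformly bounded
there, so no growth condition on `g` is needed, and `p` can be arbitrarily large. -/
lemma IsH2loc.tendstoL2loc_comp_mollify (h : IsH2loc u G H) {g : ℝ → ℝ} (hg : Continuous g) :
    TendstoL2loc (fun n x => g (mollify u n x)) (fun x => g (u x)) := by
  intro K hK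
  have : IsFiniteMeasure (volume.restrict K) := ⟨by simpa using hK.measure_lt_top⟩
  obtain ⟨M, hM⟩ := h.exists_forall_mollify_abs_le hK
  obtain ⟨M', hM'⟩ := h.exists_ae_abs_le hK
  obtain ⟨C, hC⟩ := exists_abs_comp_le hg M
  obtain ⟨C', hC'⟩ := exists_abs_comp_le hg M'
  have hmeas : ∀ n, AEStronglyMeasurable (fun x => g (mollify u n x) - g (u x))
      (volume.restrict K) := fun n =>
    (hg.comp_aestronglyMeasurable
      (contDiff_mollify h.mem.locallyIntegrable n).continuous.aestronglyMeasurable).sub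
      (hg.comp_aestronglyMeasurable (h.mem K hK).1)
  have hlim : Tendsto (fun n => ∫⁻ x in K, ‖g (mollify u n x) - g (u x)‖ₑ ^ (2 : ℝ)) atTop
      (𝓝 (∫⁻ x in K, 0)) := by
    refine tendsto_lintegral_of_dominated_convergence'
      (fun _ => ENNReal.ofReal (C + C') ^ (2 : ℝ)) (fun n => (hmeas n).enorm.pow_const _)
      (fun n => ?_) (by simp [ENNReal.mul_eq_top, hK.measure_lt_top.ne]) ?_
    · filter_upwards [ae_restrict_mem hK.measurableSet, hM'] with x hx hx'
      gcongr
      rw [Real.enorm_eq_ofReal_abs]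
      refine ENNReal.ofReal_le_ofReal ((abs_sub _ _).trans ?_)
      exact add_le_add (hC _ (hM n x hx)) (hC' _ hx')
    · filter_upwards [ae_restrict_of_ae (ae_tendsto_mollify h.mem.locallyIntegrable)] with x hx
      have h1 : Tendsto (fun n => g (mollify u n x) - g (u x)) atTop (𝓝 0) := by
        simpa using ((hg.tendsto (u x)).comp hx).sub_const (g (u x))
      have h2 := (ENNReal.continuous_rpow_const (y := 2)).tendsto _ |>.comp h1.enorm
      simpa [Function.comp_def] using h2
  rw [lintegral_zero] at hlim
  have h3 := (ENNReal.continuous_rpow_const (y := 1 / 2)).tendsto _ |>.comp hlim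
  refine (h3.congr fun n => ?_).trans (by simp)
  rw [eLpNorm_eq_lintegral_rpow_enorm_toReal (by simp) (by simp)]
  simp

/-! ### Powers of `|u|` and the pointwise equation. -/

lemma continuous_abs_rpow_mul {p : ℝ} (hp : 1 ≤ p) :
    Continuous fun t : ℝ => |t| ^ (p - 1) * t :=
  (continuous_abs.rpow_const fun _ => Or.inr (by linarith)).mul continuous_id

lemma continuous_abs_rpow {q : ℝ} (hq : 0 ≤ q) : Continuous fun t : ℝ => |t| ^ q :=
  continuous_abs.rpow_const fun _ => Or.inr hq

/-- Since `p + 1 > 1`, the function `|t|^{p+1}` is differentiable even at `0`, with derivative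
`(p+1)|t|^{p-1}t`; ordinary integration by parts applies. -/
lemma integral_abs_rpow_of_smooth {v : R3 → ℝ} (hv : ContDiff ℝ ∞ v) {p : ℝ} (hp : 1 ≤ p)
    {θ : R3 → ℝ} (hθ : IsTestFunction θ) (i : Fin 3) :
    (p + 1) * ∫ x, θ x * (|v x| ^ (p - 1) * v x) * partialDeriv i v x
      = - ∫ x, partialDeriv i θ x * |v x| ^ (p + 1) := by
  have hθ' := hθ.pderiv i
  have hd : ∀ x, HasFDerivAt (fun x => |v x| ^ (p + 1))
      (((p + 1) * |v x| ^ (p + 1 - 2) * v x) • fderiv ℝ v x) x := fun x =>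
    (hasDerivAt_abs_rpow (v x) (by linarith : 1 < p + 1)).comp_hasFDerivAt x
      (differentiable_of_smooth hv x).hasFDerivAt
  have hd' : ∀ x, fderiv ℝ (fun x => |v x| ^ (p + 1)) x (EuclideanSpace.single i 1)
      = (p + 1) * ((|v x| ^ (p - 1) * v x) * partialDeriv i v x) := by
    intro x
    rw [(hd x).fderiv]
    simp only [_root_.smul_apply, smul_eq_mul, partialDeriv]
    rw [show p + 1 - 2 = p - 1 by ring]
    ring
  have hc1 : Continuous fun x => (p + 1) * ((|v x| ^ (p - 1) * v x) * partialDeriv i v x) :=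
    continuous_const.mul (((continuous_abs_rpow_mul hp).comp hv.continuous).mul
      (contDiff_partialDeriv hv i).continuous)
  have hc2 : Continuous fun x => |v x| ^ (p + 1) :=
    (continuous_abs_rpow (by linarith)).comp hv.continuous
  have i1 : Integrable (fun x => (p + 1) * ((|v x| ^ (p - 1) * v x) * partialDeriv i v x) * θ x)
      volume :=
    (hc1.mul hθ.smooth.continuous).integrable_of_hasCompactSupport hθ.compact.mul_left
  have i2 : Integrable (fun x => |v x| ^ (p + 1) * partialDeriv i θ x) volume :=
    (hc2.mul hθ'.smooth.continuous).integrable_of_hasCompactSupport hθ'.compact.mul_left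
  have i3 : Integrable (fun x => |v x| ^ (p + 1) * θ x) volume :=
    (hc2.mul hθ.smooth.continuous).integrable_of_hasCompactSupport hθ.compact.mul_left
  have ibp := integral_mul_fderiv_eq_neg_fderiv_mul_of_integrable (μ := (volume : Measure R3))
    (f := fun x => |v x| ^ (p + 1)) (g := θ) (v := EuclideanSpace.single i (1 : ℝ))
    (by simp only [hd']; exact i1) i2 i3
    (fun x _ => (hd x).differentiableAt) (fun x _ => differentiable_of_smooth hθ.smooth x)
  simp only [hd'] at ibp
  have e1 : ∫ x, partialDeriv i θ x * |v x| ^ (p + 1)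
      = ∫ x, |v x| ^ (p + 1) * fderiv ℝ θ x (EuclideanSpace.single i 1) := by
    simp only [partialDeriv, mul_comm]
  rw [e1, ibp, neg_neg, ← integral_const_mul]
  refine integral_congr_ae (Eventually.of_forall fun x => ?_)
  dsimp only
  ring

/-- The chain rule for `|u|^{p+1}`. -/
lemma IsH2loc.integral_abs_rpow (h : IsH2loc u G H) {p : ℝ} (hp : 1 ≤ p) {θ : R3 → ℝ}
    (hθ : IsTestFunction θ) (i : Fin 3) :
    (p + 1) * ∫ x, θ x * (|u x| ^ (p - 1) * u x) * G i x
      = - ∫ x, partialDeriv i θ x * |u x| ^ (p + 1) := by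
  have hθ' := hθ.pderiv i
  have hg1 := continuous_abs_rpow_mul hp
  have hg2 := continuous_abs_rpow (q := p + 1) (by linarith)
  have hs := fun n => contDiff_mollify h.mem.locallyIntegrable n
  have hsG := fun n => contDiff_mollify (h.mem_grad i).locallyIntegrable n
  have one : MemL2loc fun _ => (1 : ℝ) := continuous_const.memL2loc
  have m1 : ∀ n, MemL2loc fun x => |mollify u n x| ^ (p - 1) * mollify u n x := fun n =>
    Continuous.memL2loc (hg1.comp (hs n).continuous)
  have m2 : ∀ n, MemL2loc fun x => |mollify u n x| ^ (p + 1) := fun n =>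
    Continuous.memL2loc (hg2.comp (hs n).continuous)
  have l1 := h.memL2loc_comp hg1
  have l2 := h.memL2loc_comp hg2
  have c1 := h.tendstoL2loc_comp_mollify hg1
  have c2 := h.tendstoL2loc_comp_mollify hg2
  have t1 := tendsto_integral_mul_mul m1
    (fun n => (hsG n).continuous.memL2loc) l1 (h.mem_grad i) c1 (tendstoL2loc_mollify (h.mem_grad i))
    hθ.smooth.continuous hθ.compact
  have t2 := tendsto_integral_mul_mul m2
    (fun n => one) l2 one c2 (tendstoL2loc_const _)
    hθ'.smooth.continuous hθ'.compact
  simp only [mul_one] at t2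
  refine tendsto_nhds_unique (t1.const_mul (p + 1)) (t2.neg.congr fun n => ?_)
  rw [← partialDeriv_mollify (h.grad i), integral_abs_rpow_of_smooth (hs n) hp hθ i]

/-- The equation holds almost everywhere for weak solutions in `H²_loc`. -/
lemma IsH2loc.ae_equation (h : IsH2loc u G H) {μ p : ℝ} (hu : IsWeakSolution μ p u) :
    ∀ᵐ x, potential u x * u x = μ * (|u x| ^ (p - 1) * u x) + ∑ j, H j j x := by
  obtain ⟨G', hG', heq⟩ := hu.equation
  have hGG : ∀ i, G' i =ᵐ[volume] G i := fun i => (hG' i).ae_eq (h.grad i)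
  have hH : LocallyIntegrable (fun x => ∑ j, H j j x) volume :=
    (MemL2loc.sum _ fun j _ => h.mem_hess j j).locallyIntegrable
  have hP : LocallyIntegrable (fun x => μ * (|u x| ^ (p - 1) * u x)) volume :=
    hu.locallyIntegrable_power.smul μ
  refine ae_eq_of_integral_contDiff_smul_eq hu.locallyIntegrable_potential (hP.add hH)
    fun ψ hψ hψc => ?_
  have hψ' : IsTestFunction ψ := ⟨hψ, hψc⟩
  have e := heq ψ hψ'
  have e1 : ∫ x, ∑ i, G' i x * partialDeriv i ψ x = - ∫ x, ψ x * ∑ j, H j j x := by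
    have hint : ∀ i, Integrable (fun x => partialDeriv i ψ x * G i x) volume := fun i =>
      (h.mem_grad i).locallyIntegrable.integrable_smul_left_of_hasCompactSupport
        (hψ'.pderiv i).smooth.continuous (hψ'.pderiv i).compact
    have hint2 : ∀ j, Integrable (fun x => ψ x * H j j x) volume := fun j =>
      (h.mem_hess j j).locallyIntegrable.integrable_smul_left_of_hasCompactSupport
        hψ.continuous hψc
    have e2 : ∫ x, ∑ i, G' i x * partialDeriv i ψ x = ∫ x, ∑ i, partialDeriv i ψ x * G i x := by
      refine integral_congr_ae ?_
      filter_upwards [ae_all_iff.2 hGG] with x hx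
      exact Finset.sum_congr rfl fun i _ => by rw [hx i, mul_comm]
    rw [e2, integral_finsetSum _ fun i _ => hint i]
    simp only [Finset.mul_sum]
    rw [integral_finsetSum _ fun j _ => hint2 j, ← Finset.sum_neg_distrib]
    refine Finset.sum_congr rfl fun i _ => ?_
    have := (h.hess i i).integral_eq ψ hψ'
    simpa only [mul_comm] using this
  have i1 : Integrable (fun x => ψ x * (μ * (|u x| ^ (p - 1) * u x))) volume :=
    hP.integrable_smul_left_of_hasCompactSupport hψ.continuous hψc
  have i2 : Integrable (fun x => ψ x * ∑ j, H j j x) volume :=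
    hH.integrable_smul_left_of_hasCompactSupport hψ.continuous hψc
  simp only [smul_eq_mul, mul_add]
  rw [integral_add i1 i2]
  have e3 : ∫ x, ψ x * (μ * (|u x| ^ (p - 1) * u x)) = μ * ∫ x, |u x| ^ (p - 1) * u x * ψ x := by
    rw [← integral_const_mul]
    refine integral_congr_ae (Eventually.of_forall fun x => ?_)
    dsimp only
    ring
  have e4 : ∫ x, ψ x * (potential u x * u x) = ∫ x, potential u x * u x * ψ x := by
    simp only [mul_comm (ψ _)]
  rw [e3, e4]
  linarith

end

/-! ### A smooth regularization of `1/|z|` -/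

/-- The regularized kernel `(|z|² + δ²)^{-1/2}`. -/
def softInv (δ : ℝ) (z : R3) : ℝ := (√(‖z‖ ^ 2 + δ ^ 2))⁻¹

lemma softInv_nonneg (δ : ℝ) (z : R3) : 0 ≤ softInv δ z := by
  unfold softInv
  positivity

lemma softInv_le {δ : ℝ} {z : R3} (hz : z ≠ 0) : softInv δ z ≤ 1 / ‖z‖ := by
  have hz' : 0 < ‖z‖ := norm_pos_iff.2 hz
  rw [softInv, one_div]
  refine inv_anti₀ hz' (Real.le_sqrt_of_sq_le ?_)
  nlinarith [sq_nonneg δ]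

lemma softInv_le_inv {δ : ℝ} (hδ : 0 < δ) (z : R3) : softInv δ z ≤ δ⁻¹ := by
  rw [softInv]
  refine inv_anti₀ hδ (Real.le_sqrt_of_sq_le ?_)
  nlinarith [sq_nonneg ‖z‖]

lemma norm_mul_softInv_le {δ : ℝ} (hδ : 0 < δ) (z : R3) : ‖z‖ * softInv δ z ≤ 1 := by
  rw [softInv, mul_inv_le_iff₀ (by positivity), one_mul]
  refine Real.le_sqrt_of_sq_le ?_
  nlinarith [sq_nonneg δ]

lemma contDiff_softInv {δ : ℝ} (hδ : 0 < δ) : ContDiff ℝ ∞ (softInv δ) := by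
  have hpos : ∀ z : R3, ‖z‖ ^ 2 + δ ^ 2 ≠ 0 := fun z => by positivity
  exact (((contDiff_id.norm_sq ℝ).add contDiff_const).sqrt hpos).inv fun z => by positivity

lemma contDiff_softInv_sub {δ : ℝ} (hδ : 0 < δ) (y : R3) :
    ContDiff ℝ ∞ fun x => softInv δ (x - y) :=
  (contDiff_softInv hδ).comp (contDiff_id.sub contDiff_const)

lemma partialDeriv_softInv_sub {δ : ℝ} (hδ : 0 < δ) (y x : R3) (i : Fin 3) :
    partialDeriv i (fun x => softInv δ (x - y)) x = -(x i - y i) * softInv δ (x - y) ^ 3 := by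
  have hpos : ‖x - y‖ ^ 2 + δ ^ 2 ≠ 0 := by positivity
  have hs : √(‖x - y‖ ^ 2 + δ ^ 2) ≠ 0 := by positivity
  have h1 : HasFDerivAt (fun x : R3 => ‖x - y‖ ^ 2 + δ ^ 2) (2 • innerSL ℝ (x - y)) x := by
    have h := ((hasFDerivAt_id x).sub_const y).norm_sq.add_const (δ ^ 2)
    simpa using! h
  have h2 := ((hasDerivAt_inv hs).comp_hasFDerivAt x (h1.sqrt hpos)).fderiv
  simp only [partialDeriv]
  change fderiv ℝ (Inv.inv ∘ fun x : R3 => √(‖x - y‖ ^ 2 + δ ^ 2)) x _ = _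
  rw [h2]
  simp [softInv, EuclideanSpace.inner_single_right]
  field_simp
  ring

lemma tendsto_softInv {z : R3} (hz : z ≠ 0) :
    Tendsto (fun n : ℕ => softInv (1 / ((n : ℝ) + 1)) z) atTop (𝓝 (1 / ‖z‖)) := by
  have h : Tendsto (fun n : ℕ => ‖z‖ ^ 2 + (1 / ((n : ℝ) + 1)) ^ 2) atTop
      (𝓝 (‖z‖ ^ 2 + 0 ^ 2)) :=
    (tendsto_one_div_add_atTop_nhds_zero_nat.pow 2).const_add _
  have h2 := (h.sqrt).inv₀ (by
    have : 0 < ‖z‖ := norm_pos_iff.2 hz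
    positivity)
  simpa [softInv] using h2

/-! ### The Coulomb energy density -/

/-- The density `u²(x) u²(y) / |x - y|`. -/
def coulombDensity (u : R3 → ℝ) (z : R3 × R3) : ℝ := u z.1 ^ 2 * u z.2 ^ 2 / ‖z.1 - z.2‖

lemma coulombDensity_nonneg (u : R3 → ℝ) (z : R3 × R3) : 0 ≤ coulombDensity u z := by
  unfold coulombDensity
  positivity

lemma aestronglyMeasurable_sq_mul_sq {u : R3 → ℝ} (hu : AEStronglyMeasurable u volume) :
    AEStronglyMeasurable (fun z : R3 × R3 => u z.1 ^ 2 * u z.2 ^ 2) (volume.prod volume) :=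
  (hu.comp_fst.pow 2).mul (hu.comp_snd.pow 2)

lemma measurable_one_div_norm_sub :
    Measurable (fun z : R3 × R3 => 1 / ‖z.1 - z.2‖) :=
  measurable_const.div (measurable_fst.sub measurable_snd).norm

lemma integrable_coulombDensity {u : R3 → ℝ} (hu : AEStronglyMeasurable u volume)
    (h : coulombEnergy u < ⊤) : Integrable (coulombDensity u) (volume.prod volume) := by
  have hm : AEStronglyMeasurable (coulombDensity u) (volume.prod volume) := by
    have := (aestronglyMeasurable_sq_mul_sq hu).mul
      measurable_one_div_norm_sub.aestronglyMeasurable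
    refine this.congr (Eventually.of_forall fun z => ?_)
    simp [coulombDensity, div_eq_mul_inv]
  refine ⟨hm, ?_⟩
  rw [hasFiniteIntegral_iff_ofReal (Eventually.of_forall (coulombDensity_nonneg u)),
    lintegral_prod _ hm.aemeasurable.ennreal_ofReal]
  exact h

lemma ae_ne_prod : ∀ᵐ z : R3 × R3 ∂(volume.prod volume), z.1 - z.2 ≠ 0 := by
  have hms : MeasurableSet {z : R3 × R3 | z.1 - z.2 = 0} :=
    measurableSet_eq_fun (measurable_fst.sub measurable_snd) measurable_const
  have h0 : (volume.prod volume) {z : R3 × R3 | z.1 - z.2 = 0} = 0 := by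
    rw [Measure.measure_prod_null hms]
    refine Eventually.of_forall fun x => ?_
    have : Prod.mk x ⁻¹' {z : R3 × R3 | z.1 - z.2 = 0} = {x} := by
      ext y
      simp [sub_eq_zero, eq_comm]
    change volume (Prod.mk x ⁻¹' _) = 0
    rw [this]
    simp
  rw [ae_iff]
  simpa using h0

/-- Fubini for the energy, divided by `u(x)²`. Where `u x = 0` finite energy gives no information,
but there the integrands of interest vanish. -/
lemma ae_integrable_section {u : R3 → ℝ} (hc : Integrable (coulombDensity u) (volume.prod volume)) :
    ∀ᵐ x, u x ≠ 0 → Integrable (fun y => u y ^ 2 * (1 / ‖x - y‖)) volume := by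
  filter_upwards [hc.prod_right_ae] with x hx hux
  have := hx.const_mul ((u x ^ 2)⁻¹)
  refine this.congr (Eventually.of_forall fun y => ?_)
  simp only [coulombDensity]
  field_simp

lemma potential_eq (u : R3 → ℝ) (x : R3) :
    ∫ y, u y ^ 2 * (1 / ‖x - y‖) = 4 * Real.pi * potential u x := by
  rw [potential_apply, ← integral_const_mul]
  refine integral_congr_ae (Eventually.of_forall fun y => ?_)
  have := Real.pi_ne_zero
  dsimp only
  rw [one_div, one_div, mul_inv]
  field_simp

/-- If `f φ_u u` is integrable, then so is `f(x) u(x) u²(y) / |x - y|`. -/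
lemma integrable_mul_kernel {u f : R3 → ℝ} (hu : AEStronglyMeasurable u volume)
    (hc : Integrable (coulombDensity u) (volume.prod volume)) (hf : AEStronglyMeasurable f volume)
    (hfi : Integrable (fun x => f x * (potential u x * u x)) volume) :
    Integrable (fun z : R3 × R3 => f z.1 * u z.1 * (u z.2 ^ 2 * (1 / ‖z.1 - z.2‖)))
      (volume.prod volume) := by
  have hm : AEStronglyMeasurable
      (fun z : R3 × R3 => f z.1 * u z.1 * (u z.2 ^ 2 * (1 / ‖z.1 - z.2‖))) (volume.prod volume) :=
    (hf.comp_fst.mul hu.comp_fst).mul ((hu.comp_snd.pow 2).mul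
      measurable_one_div_norm_sub.aestronglyMeasurable)
  rw [integrable_prod_iff hm]
  constructor
  · filter_upwards [ae_integrable_section hc] with x hx
    by_cases h0 : u x = 0
    · simp [h0]
    · exact (hx h0).const_mul _
  -- The kernel is nonnegative, so the inner integral of the norm is exactly `4π |f φ_u u|`.
  · refine (hfi.norm.const_mul (4 * Real.pi)).congr (Eventually.of_forall fun x => ?_)
    have hpot : 0 ≤ potential u x := by
      rw [potential_apply]
      exact integral_nonneg fun y => by positivity
    have e : ∀ y, ‖f x * u x * (u y ^ 2 * (1 / ‖x - y‖))‖
        = |f x * u x| * (u y ^ 2 * (1 / ‖x - y‖)) := fun y => by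
      rw [norm_mul, Real.norm_eq_abs, Real.norm_of_nonneg (by positivity)]
    simp only [e]
    rw [integral_const_mul, potential_eq, Real.norm_eq_abs, abs_mul, abs_mul, abs_mul,
      abs_of_nonneg hpot]
    ring

lemma integral_mul_kernel {u f : R3 → ℝ} (hu : AEStronglyMeasurable u volume)
    (hc : Integrable (coulombDensity u) (volume.prod volume)) (hf : AEStronglyMeasurable f volume)
    (hfi : Integrable (fun x => f x * (potential u x * u x)) volume) :
    ∫ z : R3 × R3, f z.1 * u z.1 * (u z.2 ^ 2 * (1 / ‖z.1 - z.2‖)) ∂(volume.prod volume)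
      = 4 * Real.pi * ∫ x, f x * (potential u x * u x) := by
  rw [integral_prod _ (integrable_mul_kernel hu hc hf hfi), ← integral_const_mul]
  refine integral_congr_ae (Eventually.of_forall fun x => ?_)
  dsimp only
  rw [integral_const_mul, potential_eq]
  ring

/-! ### The nonlocal term -/

lemma integrable_mul_coulombDensity {u : R3 → ℝ} {k : R3 × R3 → ℝ} {C : ℝ}
    (hu : AEStronglyMeasurable u volume)
    (hc : Integrable (coulombDensity u) (volume.prod volume)) (hk : Measurable k)
    (hkC : ∀ z : R3 × R3, z.1 - z.2 ≠ 0 → |k z| ≤ C / ‖z.1 - z.2‖) :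
    Integrable (fun z : R3 × R3 => u z.1 ^ 2 * u z.2 ^ 2 * k z) (volume.prod volume) := by
  refine (hc.const_mul C).mono' ((aestronglyMeasurable_sq_mul_sq hu).mul
    hk.aestronglyMeasurable) ?_
  filter_upwards [ae_ne_prod] with z hz
  rw [norm_mul, Real.norm_of_nonneg (by positivity), Real.norm_eq_abs, coulombDensity]
  calc u z.1 ^ 2 * u z.2 ^ 2 * |k z| ≤ u z.1 ^ 2 * u z.2 ^ 2 * (C / ‖z.1 - z.2‖) := by
        gcongr
        exact hkC z hz
    _ = _ := by ring

lemma abs_coord_le (z : R3) (i : Fin 3) : |z i| ≤ ‖z‖ := by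
  simpa using PiLp.norm_apply_le z i

/-- `∑ᵢ (Xᵢ(x) - Xᵢ(y)) (xᵢ - yᵢ)` for a vector field `X`. -/
def symmPairing (X : Fin 3 → R3 → ℝ) (z : R3 × R3) : ℝ :=
  ∑ i, (X i z.1 - X i z.2) * (z.1 i - z.2 i)

/-- The divergence of a vector field. -/
def divergence (X : Fin 3 → R3 → ℝ) (x : R3) : ℝ := ∑ i, partialDeriv i (X i) x

/-- Vanishing to second order on the diagonal is what compensates the cubed kernel produced by
differentiation. -/
lemma abs_symmPairing_le {X : Fin 3 → R3 → ℝ} {L : ℝ}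
    (hL : ∀ i x y, |X i x - X i y| ≤ L * ‖x - y‖) (z : R3 × R3) :
    |symmPairing X z| ≤ 3 * L * ‖z.1 - z.2‖ ^ 2 := by
  refine (Finset.abs_sum_le_sum_abs _ _).trans ?_
  have : ∀ i ∈ Finset.univ, |(X i z.1 - X i z.2) * (z.1 i - z.2 i)| ≤ L * ‖z.1 - z.2‖ ^ 2 := by
    intro i _
    rw [abs_mul]
    have h2 : |z.1 i - z.2 i| ≤ ‖z.1 - z.2‖ := abs_coord_le (z.1 - z.2) i
    calc |X i z.1 - X i z.2| * |z.1 i - z.2 i| ≤ (L * ‖z.1 - z.2‖) * ‖z.1 - z.2‖ :=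
          mul_le_mul (hL i _ _) h2 (abs_nonneg _) ((abs_nonneg _).trans (hL i _ _))
      _ = _ := by ring
  refine (Finset.sum_le_sum this).trans (le_of_eq ?_)
  simp
  ring

lemma continuous_coord (i : Fin 3) : Continuous fun x : R3 => x i := (contDiff_coord i).continuous

lemma measurable_symmPairing {X : Fin 3 → R3 → ℝ} (hX : ∀ i, Continuous (X i)) :
    Measurable (symmPairing X) := by
  refine Continuous.measurable (continuous_finsetSum _ fun i _ => ?_)
  exact (((hX i).comp continuous_fst).sub ((hX i).comp continuous_snd)).mul
    (((continuous_coord i).comp continuous_fst).sub ((continuous_coord i).comp continuous_snd))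

lemma IsTestFunction.exists_lipschitz {f : R3 → ℝ} (hf : IsTestFunction f) :
    ∃ L, ∀ x y, |f x - f y| ≤ L * ‖x - y‖ := by
  obtain ⟨L, hL⟩ := (hf.smooth.of_le (n := ∞) (m := 1) (by simp)).lipschitzWith_of_hasCompactSupport
    hf.compact (by simp)
  exact ⟨L, fun x y => by simpa [Real.dist_eq, dist_eq_norm] using hL.dist_le_mul x y⟩

lemma IsTestFunction.exists_abs_le {f : R3 → ℝ} (hf : IsTestFunction f) :
    ∃ C, ∀ x, |f x| ≤ C :=
  hf.compact.exists_bound_of_continuous hf.smooth.continuous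

lemma exists_common_bound {P : Fin 3 → ℝ → Prop} (hP : ∀ i a b, a ≤ b → P i a → P i b)
    (h : ∀ i, ∃ C, P i C) : ∃ C, 0 ≤ C ∧ ∀ i, P i C := by
  choose C hC using h
  refine ⟨∑ i, |C i|, Finset.sum_nonneg fun i _ => abs_nonneg _, fun i => hP i _ _ ?_ (hC i)⟩
  exact (le_abs_self _).trans (Finset.single_le_sum (f := fun i => |C i|)
    (fun i _ => abs_nonneg _) (Finset.mem_univ i))

section

variable {u : R3 → ℝ} {G : Fin 3 → R3 → ℝ} {H : Fin 3 → Fin 3 → R3 → ℝ}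

/-- The weak derivative of `u²` tested against a regularized kernel. -/
lemma IsH2loc.integral_softInv (h : IsH2loc u G H) {X : Fin 3 → R3 → ℝ}
    (hX : ∀ i, IsTestFunction (X i)) {δ : ℝ} (hδ : 0 < δ) (y : R3) :
    2 * ∫ x, (∑ i, X i x * G i x) * u x * softInv δ (x - y)
      = - ∫ x, u x ^ 2 * (divergence X x * softInv δ (x - y)
          - (∑ i, X i x * (x i - y i)) * softInv δ (x - y) ^ 3) := by
  have hk := contDiff_softInv_sub hδ y
  have hη : ∀ i, IsTestFunction fun x => X i x * softInv δ (x - y) := fun i =>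
    (hX i).mul_right hk
  -- `u ∂ᵢu = ½ ∂ᵢ(u²)` is tested with `Xᵢ` times the regularized kernel, which is smooth and
  -- compactly supported.
  have key := fun i => h.integral_sq (hη i) i
  have i1 : ∀ i, Integrable (fun x => X i x * softInv δ (x - y) * u x * G i x) volume := fun i =>
    h.mem.integrable_mul_mul (h.mem_grad i) (hη i).smooth.continuous (hη i).compact
  have i2 : ∀ i, Integrable (fun x => partialDeriv i (fun x => X i x * softInv δ (x - y)) x
      * u x * u x) volume := fun i =>
    h.mem.integrable_mul_mul h.mem ((hη i).pderiv i).smooth.continuous ((hη i).pderiv i).compact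
  have e1 : ∫ x, (∑ i, X i x * G i x) * u x * softInv δ (x - y)
      = ∑ i, ∫ x, X i x * softInv δ (x - y) * u x * G i x := by
    rw [← integral_finsetSum _ fun i _ => i1 i]
    refine integral_congr_ae (Eventually.of_forall fun x => ?_)
    simp only [Finset.sum_mul]
    exact Finset.sum_congr rfl fun i _ => by ring
  have e2 : ∫ x, u x ^ 2 * (divergence X x * softInv δ (x - y)
          - (∑ i, X i x * (x i - y i)) * softInv δ (x - y) ^ 3)
      = ∑ i, ∫ x, partialDeriv i (fun x => X i x * softInv δ (x - y)) x * u x * u x := by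
    rw [← integral_finsetSum _ fun i _ => i2 i]
    refine integral_congr_ae (Eventually.of_forall fun x => ?_)
    simp only [divergence, Finset.sum_mul, ← Finset.sum_sub_distrib, Finset.mul_sum]
    refine Finset.sum_congr rfl fun i _ => ?_
    rw [partialDeriv_mul (hX i).smooth hk, partialDeriv_softInv_sub hδ]
    ring
  rw [e1, e2, Finset.mul_sum, ← Finset.sum_neg_distrib]
  exact Finset.sum_congr rfl fun i _ => key i

end

lemma measurable_softInv_sub {δ : ℝ} (hδ : 0 < δ) :
    Measurable fun z : R3 × R3 => softInv δ (z.1 - z.2) :=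
  (contDiff_softInv hδ).continuous.measurable.comp (measurable_fst.sub measurable_snd)

lemma norm_pow_two_mul_softInv_pow_three_le {δ : ℝ} (hδ : 0 < δ) (z : R3) :
    ‖z‖ ^ 2 * softInv δ z ^ 3 ≤ softInv δ z := by
  have h1 := norm_mul_softInv_le hδ z
  have h0 := softInv_nonneg δ z
  have h2 : (‖z‖ * softInv δ z) ^ 2 ≤ 1 := pow_le_one₀ (by positivity) h1
  calc ‖z‖ ^ 2 * softInv δ z ^ 3 = (‖z‖ * softInv δ z) ^ 2 * softInv δ z := by ring
    _ ≤ 1 * softInv δ z := by gcongr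
    _ = _ := one_mul _

lemma norm_mul_softInv_le_norm {δ : ℝ} (a b : ℝ) {z : R3} (hz : z ≠ 0) :
    ‖a * (b ^ 2 * softInv δ z)‖ ≤ ‖a * (b ^ 2 * (1 / ‖z‖))‖ := by
  rw [norm_mul, norm_mul a]
  refine mul_le_mul_of_nonneg_left ?_ (norm_nonneg a)
  have h0 := softInv_nonneg δ z
  rw [Real.norm_of_nonneg (by positivity), Real.norm_of_nonneg (by positivity)]
  exact mul_le_mul_of_nonneg_left (softInv_le hz) (sq_nonneg b)

lemma abs_sum_mul_coord_le {X : Fin 3 → R3 → ℝ} {M : ℝ} (hM : ∀ i x, |X i x| ≤ M)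
    (z : R3 × R3) : |∑ i, X i z.1 * (z.1 i - z.2 i)| ≤ 3 * M * ‖z.1 - z.2‖ := by
  refine (Finset.abs_sum_le_sum_abs _ _).trans ?_
  have : ∀ i ∈ Finset.univ, |X i z.1 * (z.1 i - z.2 i)| ≤ M * ‖z.1 - z.2‖ := by
    intro i _
    rw [abs_mul]
    exact mul_le_mul (hM i _) (abs_coord_le (z.1 - z.2) i) (abs_nonneg _)
      ((abs_nonneg _).trans (hM i z.1))
  refine (Finset.sum_le_sum this).trans (le_of_eq ?_)
  simp
  ring

lemma measurable_sum_mul_coord {X : Fin 3 → R3 → ℝ} (hX : ∀ i, Continuous (X i)) :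
    Measurable fun z : R3 × R3 => ∑ i, X i z.1 * (z.1 i - z.2 i) := by
  refine Continuous.measurable (continuous_finsetSum _ fun i _ => ?_)
  exact ((hX i).comp continuous_fst).mul
    (((continuous_coord i).comp continuous_fst).sub ((continuous_coord i).comp continuous_snd))

lemma continuous_divergence {X : Fin 3 → R3 → ℝ} (hX : ∀ i, ContDiff ℝ ∞ (X i)) :
    Continuous (divergence X) :=
  continuous_finsetSum _ fun i _ => (contDiff_partialDeriv (hX i) i).continuous

lemma exists_abs_divergence_le {X : Fin 3 → R3 → ℝ} (hX : ∀ i, IsTestFunction (X i)) :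
    ∃ C, ∀ x, |divergence X x| ≤ C := by
  choose C hC using fun i => ((hX i).pderiv i).exists_abs_le
  exact ⟨∑ i, C i, fun x => (Finset.abs_sum_le_sum_abs _ _).trans
    (Finset.sum_le_sum fun i _ => hC i x)⟩

section

variable {u : R3 → ℝ} {X : Fin 3 → R3 → ℝ}

/-- Without symmetrization the factor is only `O(|x-y|)`, so the bound costs a power of `δ⁻¹`. It
serves at fixed `δ`, to justify the symmetrization, and not in the limit. -/
lemma integrable_coulomb_sum_mul_coord (hu : AEStronglyMeasurable u volume)
    (hc : Integrable (coulombDensity u) (volume.prod volume)) (hX : ∀ i, IsTestFunction (X i))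
    {δ : ℝ} (hδ : 0 < δ) :
    Integrable (fun z : R3 × R3 => u z.1 ^ 2 * u z.2 ^ 2 *
      ((∑ i, X i z.1 * (z.1 i - z.2 i)) * softInv δ (z.1 - z.2) ^ 3)) (volume.prod volume) := by
  obtain ⟨M, hM0, hM⟩ := exists_common_bound (P := fun i C => ∀ x, |X i x| ≤ C)
    (fun i a b hab h x => (h x).trans hab) fun i => (hX i).exists_abs_le
  refine integrable_mul_coulombDensity (C := 3 * M * δ⁻¹) hu hc
    ((measurable_sum_mul_coord fun i => (hX i).smooth.continuous).mul
      ((measurable_softInv_sub hδ).pow_const 3)) fun z hz => ?_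
  set k := softInv δ (z.1 - z.2)
  have hk0 : 0 ≤ k := softInv_nonneg _ _
  have h1 : ‖z.1 - z.2‖ * k ≤ 1 := norm_mul_softInv_le hδ _
  have h2 : k ≤ δ⁻¹ := softInv_le_inv hδ _
  have h3 : k ≤ 1 / ‖z.1 - z.2‖ := softInv_le hz
  rw [abs_mul, abs_of_nonneg (pow_nonneg hk0 3)]
  calc |∑ i, X i z.1 * (z.1 i - z.2 i)| * k ^ 3
      ≤ 3 * M * ‖z.1 - z.2‖ * k ^ 3 := by
        gcongr
        exact abs_sum_mul_coord_le hM z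
    _ = 3 * M * (‖z.1 - z.2‖ * k) * k * k := by ring
    _ ≤ 3 * M * 1 * δ⁻¹ * (1 / ‖z.1 - z.2‖) := by gcongr
    _ = _ := by ring

/-- Symmetrization of the singular term of the nonlocal identity. -/
lemma two_mul_integral_coulomb_sum_mul_coord (hu : AEStronglyMeasurable u volume)
    (hc : Integrable (coulombDensity u) (volume.prod volume)) (hX : ∀ i, IsTestFunction (X i))
    {δ : ℝ} (hδ : 0 < δ) :
    2 * ∫ z : R3 × R3, u z.1 ^ 2 * u z.2 ^ 2 *
        ((∑ i, X i z.1 * (z.1 i - z.2 i)) * softInv δ (z.1 - z.2) ^ 3) ∂(volume.prod volume)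
      = ∫ z : R3 × R3, u z.1 ^ 2 * u z.2 ^ 2 *
        (symmPairing X z * softInv δ (z.1 - z.2) ^ 3) ∂(volume.prod volume) := by
  have hi := integrable_coulomb_sum_mul_coord hu hc hX hδ
  have hs := integral_prod_swap (μ := (volume : Measure R3)) (ν := (volume : Measure R3))
    (fun z : R3 × R3 => u z.1 ^ 2 * u z.2 ^ 2 *
        ((∑ i, X i z.1 * (z.1 i - z.2 i)) * softInv δ (z.1 - z.2) ^ 3))
  rw [two_mul]
  nth_rewrite 2 [← hs]
  refine (integral_add hi hi.swap).symm.trans ?_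
  refine integral_congr_ae (Eventually.of_forall fun z => ?_)
  have e1 : softInv δ (z.2 - z.1) = softInv δ (z.1 - z.2) := by
    simp only [softInv, norm_sub_rev]
  simp only [Function.comp_apply, Prod.fst_swap, Prod.snd_swap, e1, symmPairing]
  -- Exchanging the points reverses the sign of `x - y` and leaves the even kernel unchanged, so the
  -- two copies add up to a difference of `X`.
  have e2 : ∑ i, (X i z.1 - X i z.2) * (z.1 i - z.2 i)
      = (∑ i, X i z.1 * (z.1 i - z.2 i)) + ∑ i, X i z.2 * (z.2 i - z.1 i) := by
    rw [← Finset.sum_add_distrib]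
    exact Finset.sum_congr rfl fun i _ => by ring
  rw [e2]
  ring

lemma integrable_coulomb_divergence (hu : AEStronglyMeasurable u volume)
    (hc : Integrable (coulombDensity u) (volume.prod volume)) (hX : ∀ i, IsTestFunction (X i))
    {δ : ℝ} (hδ : 0 < δ) :
    Integrable (fun z : R3 × R3 => u z.1 ^ 2 * u z.2 ^ 2 *
      (divergence X z.1 * softInv δ (z.1 - z.2))) (volume.prod volume) := by
  obtain ⟨C, hC⟩ := exists_abs_divergence_le hX
  refine integrable_mul_coulombDensity (C := C) hu hc
    (((continuous_divergence fun i => (hX i).smooth).measurable.comp measurable_fst).mul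
      (measurable_softInv_sub hδ)) fun z hz => ?_
  rw [abs_mul, abs_of_nonneg (softInv_nonneg _ _), div_eq_mul_one_div]
  exact mul_le_mul (hC _) (softInv_le hz) (softInv_nonneg _ _) ((abs_nonneg _).trans (hC z.1))

variable {G : Fin 3 → R3 → ℝ} {H : Fin 3 → Fin 3 → R3 → ℝ}

lemma IsH2loc.integrable_field_potential (h : IsH2loc u G H)
    (hpu : MemL2loc fun x => potential u x * u x) (hX : ∀ i, IsTestFunction (X i)) :
    Integrable (fun x => (∑ i, X i x * G i x) * (potential u x * u x)) volume := by
  have hsum : Integrable (fun x => ∑ i, X i x * G i x * (potential u x * u x)) volume :=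
    integrable_finsetSum _ fun i _ =>
      (h.mem_grad i).integrable_mul_mul hpu (hX i).smooth.continuous (hX i).compact
  simpa only [Finset.sum_mul] using hsum

lemma IsH2loc.aestronglyMeasurable_field (h : IsH2loc u G H) (hX : ∀ i, IsTestFunction (X i)) :
    AEStronglyMeasurable (fun x => ∑ i, X i x * G i x) volume :=
  Finset.aestronglyMeasurable_fun_sum _ fun i _ =>
    (hX i).smooth.continuous.aestronglyMeasurable.mul (h.mem_grad i).aestronglyMeasurable

lemma IsH2loc.integrable_softInv_prod (h : IsH2loc u G H)
    (hc : Integrable (coulombDensity u) (volume.prod volume))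
    (hpu : MemL2loc fun x => potential u x * u x) (hX : ∀ i, IsTestFunction (X i))
    {δ : ℝ} (hδ : 0 < δ) :
    Integrable (fun z : R3 × R3 => (∑ i, X i z.1 * G i z.1) * u z.1 *
      (u z.2 ^ 2 * softInv δ (z.1 - z.2))) (volume.prod volume) := by
  have hu := h.mem.aestronglyMeasurable
  have hf := h.aestronglyMeasurable_field hX
  refine (integrable_mul_kernel hu hc hf (h.integrable_field_potential hpu hX)).mono
    ((hf.comp_fst.mul hu.comp_fst).mul ((hu.comp_snd.pow 2).mul
      (measurable_softInv_sub hδ).aestronglyMeasurable)) ?_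
  filter_upwards [ae_ne_prod] with z hz
  exact norm_mul_softInv_le_norm _ _ hz

/-- The nonlocal identity for the regularized kernel. -/
lemma IsH2loc.nonlocal_softInv (h : IsH2loc u G H)
    (hc : Integrable (coulombDensity u) (volume.prod volume))
    (hpu : MemL2loc fun x => potential u x * u x) (hX : ∀ i, IsTestFunction (X i))
    {δ : ℝ} (hδ : 0 < δ) :
    2 * ∫ z : R3 × R3, (∑ i, X i z.1 * G i z.1) * u z.1 *
        (u z.2 ^ 2 * softInv δ (z.1 - z.2)) ∂(volume.prod volume)
      = - ∫ z : R3 × R3, u z.1 ^ 2 * u z.2 ^ 2 * (divergence X z.1 * softInv δ (z.1 - z.2)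
          - (1 / 2) * (symmPairing X z * softInv δ (z.1 - z.2) ^ 3)) ∂(volume.prod volume) := by
  have hu := h.mem.aestronglyMeasurable
  have i1 := integrable_coulomb_divergence hu hc hX hδ
  have i2 := integrable_coulomb_sum_mul_coord hu hc hX hδ
  have s1 := two_mul_integral_coulomb_sum_mul_coord hu hc hX hδ
  have i3 : Integrable (fun z : R3 × R3 => u z.1 ^ 2 * u z.2 ^ 2 *
      (symmPairing X z * softInv δ (z.1 - z.2) ^ 3)) (volume.prod volume) := by
    obtain ⟨L, hL0, hL⟩ := exists_common_bound
      (P := fun i C => ∀ x y, |X i x - X i y| ≤ C * ‖x - y‖)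
      (fun i a b hab h x y => (h x y).trans (by gcongr)) fun i => (hX i).exists_lipschitz
    refine integrable_mul_coulombDensity (C := 3 * L) hu hc
      ((measurable_symmPairing fun i => (hX i).smooth.continuous).mul
      ((measurable_softInv_sub hδ).pow_const 3)) fun z hz => ?_
    have hk0 := softInv_nonneg δ (z.1 - z.2)
    rw [abs_mul, abs_of_nonneg (pow_nonneg hk0 3)]
    calc |symmPairing X z| * softInv δ (z.1 - z.2) ^ 3
        ≤ 3 * L * ‖z.1 - z.2‖ ^ 2 * softInv δ (z.1 - z.2) ^ 3 := by
          gcongr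
          exact abs_symmPairing_le hL z
      _ = 3 * L * (‖z.1 - z.2‖ ^ 2 * softInv δ (z.1 - z.2) ^ 3) := by ring
      _ ≤ 3 * L * (1 / ‖z.1 - z.2‖) := by
          gcongr
          exact (norm_pow_two_mul_softInv_pow_three_le hδ _).trans (softInv_le hz)
      _ = _ := by ring
  -- Fubini with `y` outermost, so that the identity `IsH2loc.integral_softInv` at fixed `y` applies
  -- to the inner integral.
  have e1 : ∫ z : R3 × R3, (∑ i, X i z.1 * G i z.1) * u z.1 *
        (u z.2 ^ 2 * softInv δ (z.1 - z.2)) ∂(volume.prod volume)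
      = ∫ y, u y ^ 2 * ∫ x, (∑ i, X i x * G i x) * u x * softInv δ (x - y) := by
    rw [integral_prod_symm _ (h.integrable_softInv_prod hc hpu hX hδ)]
    refine integral_congr_ae (Eventually.of_forall fun y => ?_)
    dsimp only
    rw [← integral_const_mul]
    refine integral_congr_ae (Eventually.of_forall fun x => ?_)
    dsimp only
    ring
  have e2 : ∫ z : R3 × R3, u z.1 ^ 2 * u z.2 ^ 2 * (divergence X z.1 * softInv δ (z.1 - z.2)
        - (∑ i, X i z.1 * (z.1 i - z.2 i)) * softInv δ (z.1 - z.2) ^ 3) ∂(volume.prod volume)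
      = ∫ y, u y ^ 2 * ∫ x, u x ^ 2 * (divergence X x * softInv δ (x - y)
          - (∑ i, X i x * (x i - y i)) * softInv δ (x - y) ^ 3) := by
    have hi : Integrable (fun z : R3 × R3 => u z.1 ^ 2 * u z.2 ^ 2 *
        (divergence X z.1 * softInv δ (z.1 - z.2)
        - (∑ i, X i z.1 * (z.1 i - z.2 i)) * softInv δ (z.1 - z.2) ^ 3)) (volume.prod volume) := by
      simpa only [mul_sub] using! i1.sub i2
    rw [integral_prod_symm _ hi]
    refine integral_congr_ae (Eventually.of_forall fun y => ?_)
    dsimp only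
    rw [← integral_const_mul]
    refine integral_congr_ae (Eventually.of_forall fun x => ?_)
    dsimp only
    ring
  have e3 : 2 * ∫ y, u y ^ 2 * ∫ x, (∑ i, X i x * G i x) * u x * softInv δ (x - y)
      = - ∫ y, u y ^ 2 * ∫ x, u x ^ 2 * (divergence X x * softInv δ (x - y)
          - (∑ i, X i x * (x i - y i)) * softInv δ (x - y) ^ 3) := by
    rw [← integral_const_mul, ← integral_neg]
    refine integral_congr_ae (Eventually.of_forall fun y => ?_)
    have := h.integral_softInv hX hδ y
    dsimp only
    rw [mul_left_comm, this, mul_neg]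
  rw [e1, e3, ← e2]
  have e4 := integral_sub i1 i2
  have e5 := integral_sub i1 (i3.const_mul (1 / 2))
  rw [integral_const_mul, ← s1] at e5
  rw [neg_inj]
  calc _ = _ := integral_congr_ae (Eventually.of_forall fun z => mul_sub _ _ _)
    _ = _ := e4
    _ = _ := by ring
    _ = _ := e5.symm
    _ = _ := integral_congr_ae (Eventually.of_forall fun z => by dsimp only; ring)

/-- The kernel of the nonlocal term in the Pohozaev identity. -/
def pohozaevKernel (X : Fin 3 → R3 → ℝ) (z : R3 × R3) : ℝ :=
  divergence X z.1 * (1 / ‖z.1 - z.2‖) - (1 / 2) * (symmPairing X z * (1 / ‖z.1 - z.2‖) ^ 3)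

lemma measurable_pohozaevKernel (hX : ∀ i, IsTestFunction (X i)) :
    Measurable (pohozaevKernel X) :=
  (((continuous_divergence fun i => (hX i).smooth).measurable.comp measurable_fst).mul
    measurable_one_div_norm_sub).sub
    (((measurable_symmPairing fun i => (hX i).smooth.continuous).mul
      (measurable_one_div_norm_sub.pow_const 3)).const_mul _)

/-- Allowing any `k` between `0` and `1/|x-y|` covers the regularized kernels, uniformly in `δ`, and
the singular one together. The pairing contributes `3L/2`, rounded up to `2L`. -/
lemma abs_pohozaevKernel_le {C L : ℝ} (hL0 : 0 ≤ L)
    (hC : ∀ x, |divergence X x| ≤ C) (hL : ∀ i x y, |X i x - X i y| ≤ L * ‖x - y‖) {z : R3 × R3}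
    (hz : z.1 - z.2 ≠ 0) {k : ℝ} (hk0 : 0 ≤ k) (hk : k ≤ 1 / ‖z.1 - z.2‖) :
    |divergence X z.1 * k - (1 / 2) * (symmPairing X z * k ^ 3)|
      ≤ (C + 2 * L) / ‖z.1 - z.2‖ := by
  have hz' : 0 < ‖z.1 - z.2‖ := norm_pos_iff.2 hz
  have hC0 : 0 ≤ C := (abs_nonneg _).trans (hC 0)
  have h1 : |divergence X z.1 * k| ≤ C * (1 / ‖z.1 - z.2‖) := by
    rw [abs_mul, abs_of_nonneg hk0]
    exact mul_le_mul (hC _) hk hk0 hC0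
  have h2 : |(1 / 2) * (symmPairing X z * k ^ 3)| ≤ 2 * L * (1 / ‖z.1 - z.2‖) := by
    rw [abs_mul, abs_mul, abs_of_nonneg (pow_nonneg hk0 3), abs_of_nonneg (by norm_num)]
    have : |symmPairing X z| * k ^ 3
        ≤ 3 * L * ‖z.1 - z.2‖ ^ 2 * (1 / ‖z.1 - z.2‖) ^ 3 := by
      gcongr
      exact abs_symmPairing_le hL z
    have e : 3 * L * ‖z.1 - z.2‖ ^ 2 * (1 / ‖z.1 - z.2‖) ^ 3 = 3 * L * (1 / ‖z.1 - z.2‖) := by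
      field_simp
    rw [e] at this
    have h3 : 0 ≤ L * (1 / ‖z.1 - z.2‖) := by positivity
    linarith
  calc _ ≤ _ := abs_sub _ _
    _ ≤ C * (1 / ‖z.1 - z.2‖) + 2 * L * (1 / ‖z.1 - z.2‖) := add_le_add h1 h2
    _ = _ := by ring

/-- The nonlocal part of the Pohozaev identity. -/
lemma IsH2loc.nonlocal (h : IsH2loc u G H)
    (hc : Integrable (coulombDensity u) (volume.prod volume))
    (hpu : MemL2loc fun x => potential u x * u x) (hX : ∀ i, IsTestFunction (X i)) :
    8 * Real.pi * ∫ x, (∑ i, X i x * G i x) * (potential u x * u x)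
      = - ∫ z : R3 × R3, u z.1 ^ 2 * u z.2 ^ 2 * pohozaevKernel X z ∂(volume.prod volume) := by
  have hu := h.mem.aestronglyMeasurable
  have hf := h.aestronglyMeasurable_field hX
  have hfi := h.integrable_field_potential hpu hX
  have hδ : ∀ n : ℕ, (0 : ℝ) < 1 / ((n : ℝ) + 1) := fun n => by positivity
  have hk := integrable_mul_kernel hu hc hf hfi
  -- Letting `δ → 0` on the left: the dominating function is the integrand with the singular kernel,
  -- integrable because `φ_u u` and `∇u` are both in `L²_loc`.
  have t1 : Tendsto (fun n : ℕ => ∫ z : R3 × R3, (∑ i, X i z.1 * G i z.1) * u z.1 *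
        (u z.2 ^ 2 * softInv (1 / ((n : ℝ) + 1)) (z.1 - z.2)) ∂(volume.prod volume)) atTop
      (𝓝 (∫ z : R3 × R3, (∑ i, X i z.1 * G i z.1) * u z.1 *
        (u z.2 ^ 2 * (1 / ‖z.1 - z.2‖)) ∂(volume.prod volume))) := by
    refine tendsto_integral_of_dominated_convergence
      (fun z => ‖(∑ i, X i z.1 * G i z.1) * u z.1 * (u z.2 ^ 2 * (1 / ‖z.1 - z.2‖))‖)
      (fun n => (h.integrable_softInv_prod hc hpu hX (hδ n)).1) hk.norm (fun n => ?_) ?_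
    · filter_upwards [ae_ne_prod] with z hz
      exact norm_mul_softInv_le_norm _ _ hz
    · filter_upwards [ae_ne_prod] with z hz
      exact ((tendsto_softInv hz).const_mul _).const_mul _
  obtain ⟨L, hL0, hL⟩ := exists_common_bound
    (P := fun i C => ∀ x y, |X i x - X i y| ≤ C * ‖x - y‖)
    (fun i a b hab h x y => (h x y).trans (by gcongr)) fun i => (hX i).exists_lipschitz
  obtain ⟨C, hC⟩ := exists_abs_divergence_le hX
  have hcX := fun i => (hX i).smooth.continuous
  -- On the right the symmetrized integrand is dominated by a fixed multiple of the Coulomb density.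
  have t2 : Tendsto (fun n : ℕ => ∫ z : R3 × R3, u z.1 ^ 2 * u z.2 ^ 2 *
        (divergence X z.1 * softInv (1 / ((n : ℝ) + 1)) (z.1 - z.2)
          - (1 / 2) * (symmPairing X z * softInv (1 / ((n : ℝ) + 1)) (z.1 - z.2) ^ 3))
          ∂(volume.prod volume)) atTop
      (𝓝 (∫ z : R3 × R3, u z.1 ^ 2 * u z.2 ^ 2 * pohozaevKernel X z ∂(volume.prod volume))) := by
    refine tendsto_integral_of_dominated_convergence (fun z => (C + 2 * L) * coulombDensity u z)
      (fun n => ?_) (hc.const_mul _) (fun n => ?_) ?_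
    · refine (aestronglyMeasurable_sq_mul_sq hu).mul (Measurable.aestronglyMeasurable ?_)
      exact (((continuous_divergence fun i => (hX i).smooth).measurable.comp measurable_fst).mul
        (measurable_softInv_sub (hδ n))).sub
        (((measurable_symmPairing hcX).mul
          ((measurable_softInv_sub (hδ n)).pow_const 3)).const_mul _)
    · filter_upwards [ae_ne_prod] with z hz
      rw [norm_mul, Real.norm_of_nonneg (by positivity), Real.norm_eq_abs, coulombDensity]
      calc _ ≤ u z.1 ^ 2 * u z.2 ^ 2 * ((C + 2 * L) / ‖z.1 - z.2‖) := by
            gcongr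
            exact abs_pohozaevKernel_le hL0 hC hL hz (softInv_nonneg _ _) (softInv_le hz)
        _ = _ := by ring
    · filter_upwards [ae_ne_prod] with z hz
      exact (((tendsto_softInv hz).const_mul _).sub
        ((((tendsto_softInv hz).pow 3).const_mul _).const_mul _)).const_mul _
  have e := tendsto_nhds_unique (t1.const_mul 2)
    (t2.neg.congr fun n => (h.nonlocal_softInv hc hpu hX (hδ n)).symm)
  rw [integral_mul_kernel hu hc hf hfi] at e
  linarith

end

/-! ### The localized Pohozaev identity -/

section

variable {u : R3 → ℝ} {G : Fin 3 → R3 → ℝ} {H : Fin 3 → Fin 3 → R3 → ℝ}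

/-- The truncated position field `χ(x) x`. -/
def cutField (χ : R3 → ℝ) (i : Fin 3) (x : R3) : ℝ := χ x * x i

lemma IsTestFunction.cutField {χ : R3 → ℝ} (hχ : IsTestFunction χ) (i : Fin 3) :
    IsTestFunction (cutField χ i) :=
  hχ.mul_right (contDiff_coord i)

lemma partialDeriv_cutField {χ : R3 → ℝ} (hχ : ContDiff ℝ ∞ χ) (i j : Fin 3) (x : R3) :
    partialDeriv j (cutField χ i) x = partialDeriv j χ x * x i + if i = j then χ x else 0 := by
  change partialDeriv j (fun x => χ x * x i) x = _
  rw [partialDeriv_mul hχ (contDiff_coord i), partialDeriv_coord]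
  simp

lemma divergence_cutField {χ : R3 → ℝ} (hχ : ContDiff ℝ ∞ χ) (x : R3) :
    divergence (cutField χ) x = 3 * χ x + ∑ i, partialDeriv i χ x * x i := by
  simp only [divergence, partialDeriv_cutField hχ, if_true, Finset.sum_add_distrib]
  simp
  ring

/-- The terms of the localized Pohozaev identity that are quadratic in the gradient. -/
def gradientError (u : R3 → ℝ) (G : Fin 3 → R3 → ℝ) (χ : R3 → ℝ) : ℝ :=
  ∑ i, ∑ j, ((1 / 2) * (∫ x, partialDeriv i χ x * x i * G j x * G j x)
    - ∫ x, partialDeriv j χ x * x i * G j x * G i x)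
  - (1 / 2) * ∑ j, ∫ x, partialDeriv j χ x * G j x * u x

/-- The weight `½` of `u` in the multiplier is chosen here: the terms `∫ χ|∇u|²` have coefficients
`3/2 - 1` from the field and `-½` from `u/2`, summing to zero. Only terms with a derivative of `χ`
survive. -/
lemma IsH2loc.integral_hess_mul_multiplier (h : IsH2loc u G H) {χ : R3 → ℝ}
    (hχ : IsTestFunction χ) :
    (∑ i, ∑ j, ∫ x, cutField χ i x * H j j x * G i x) + (1 / 2) * ∑ j, ∫ x, χ x * H j j x * u x
      = gradientError u G χ := by
  have split : ∀ (i j : Fin 3) {f g : R3 → ℝ}, MemL2loc f → MemL2loc g →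
      ∫ x, partialDeriv j (cutField χ i) x * f x * g x
        = (∫ x, partialDeriv j χ x * x i * f x * g x) + if i = j then ∫ x, χ x * f x * g x else 0 := by
    intro i j f g hf hg
    have hθ : IsTestFunction fun x => partialDeriv j χ x * x i :=
      (hχ.pderiv j).mul_right (contDiff_coord i)
    have i1 := hf.integrable_mul_mul hg hθ.smooth.continuous hθ.compact
    have i2 := hf.integrable_mul_mul hg hχ.smooth.continuous hχ.compact
    simp only [partialDeriv_cutField hχ.smooth]
    split_ifs
    · rw [← integral_add i1 i2]
      refine integral_congr_ae (Eventually.of_forall fun x => ?_)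
      dsimp only
      ring
    · simp
  have hm := h.mem_grad
  have e1 : ∀ i j, ∫ x, cutField χ i x * H j j x * G i x
      = ((1 / 2) * (∫ x, partialDeriv i χ x * x i * G j x * G j x)
        - ∫ x, partialDeriv j χ x * x i * G j x * G i x)
        + ((1 / 2) * (∫ x, χ x * G j x * G j x)
          - if i = j then ∫ x, χ x * G j x * G i x else 0) := by
    intro i j
    rw [h.integral_hess_mul_grad (hχ.cutField i) i j, split i i (hm j) (hm j),
      split i j (hm j) (hm i), if_pos rfl]
    ring
  simp only [e1, h.integral_hess_mul hχ, gradientError, Finset.sum_add_distrib,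
    Finset.sum_sub_distrib, Finset.sum_neg_distrib, Finset.sum_ite_eq, Finset.mem_univ, if_true,
    Finset.sum_const, Finset.card_univ, Fintype.card_fin, nsmul_eq_mul, ← Finset.mul_sum]
  push_cast
  ring

/-- The localized Pohozaev identity. -/
lemma IsH2loc.pohozaev (h : IsH2loc u G H) {μ p : ℝ} (hp : 1 ≤ p) (hu : IsWeakSolution μ p u)
    (hc : Integrable (coulombDensity u) (volume.prod volume)) {χ : R3 → ℝ}
    (hχ : IsTestFunction χ) :
    ∫ z : R3 × R3, u z.1 ^ 2 * u z.2 ^ 2 *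
        (χ z.1 * (1 / ‖z.1 - z.2‖) - pohozaevKernel (cutField χ) z) ∂(volume.prod volume)
      = 8 * Real.pi * (μ * (∫ x, ((1 / 2) * χ x - (p + 1)⁻¹ * divergence (cutField χ) x)
          * |u x| ^ (p + 1)) + gradientError u G χ) := by
  have hmu := h.mem.aestronglyMeasurable
  have hX := fun i => hχ.cutField i
  have hpw : MemL2loc fun x => |u x| ^ (p - 1) * u x := h.memL2loc_comp (continuous_abs_rpow_mul hp)
  have hpw1 : MemL2loc fun x => |u x| ^ (p + 1) :=
    h.memL2loc_comp (continuous_abs_rpow (by linarith))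
  have hL : MemL2loc fun x => ∑ j, H j j x := MemL2loc.sum _ fun j _ => h.mem_hess j j
  have hae := h.ae_equation hu
  -- Square integrability of `φ_u u` is read off from the equation, whose other two terms are in
  -- `L²_loc`.
  have hpu : MemL2loc fun x => potential u x * u x := by
    have hμ : MemL2loc fun x => μ * (|u x| ^ (p - 1) * u x) :=
      hpw.mul_continuous continuous_const
    exact (hμ.add hL).congr (hae.mono fun x hx => hx.symm)
  -- testing the equation against `θ g`
  have test : ∀ {θ g : R3 → ℝ}, IsTestFunction θ → MemL2loc g →
      ∫ x, θ x * (potential u x * u x) * g x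
        = μ * (∫ x, θ x * (|u x| ^ (p - 1) * u x) * g x) + ∑ j, ∫ x, θ x * H j j x * g x := by
    intro θ g hθ hg
    have i1 := hpw.integrable_mul_mul hg hθ.smooth.continuous hθ.compact
    have i2 := fun j => (h.mem_hess j j).integrable_mul_mul hg hθ.smooth.continuous hθ.compact
    rw [← integral_finsetSum _ fun j _ => i2 j, ← integral_const_mul,
      ← integral_add (i1.const_mul μ) (integrable_finsetSum _ fun j _ => i2 j)]
    refine integral_congr_ae ?_
    filter_upwards [hae] with x hx
    rw [hx, mul_add, add_mul, Finset.mul_sum, Finset.sum_mul]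
    ring
  have power : ∀ i, ∫ x, cutField χ i x * (|u x| ^ (p - 1) * u x) * G i x
      = - ((p + 1)⁻¹ * ∫ x, partialDeriv i (cutField χ i) x * |u x| ^ (p + 1)) := by
    intro i
    have := h.integral_abs_rpow hp (hX i) i
    have hp1 : p + 1 ≠ 0 := by linarith
    rw [← mul_neg, ← this, inv_mul_cancel_left₀ hp1]
  have one : MemL2loc fun _ => (1 : ℝ) := continuous_const.memL2loc
  have ipw : ∀ {θ : R3 → ℝ}, IsTestFunction θ → Integrable (fun x => θ x * |u x| ^ (p + 1)) volume :=
    fun {θ} hθ => by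
      simpa using hpw1.integrable_mul_mul one hθ.smooth.continuous hθ.compact
  have hdiv : ∑ i, ∫ x, partialDeriv i (cutField χ i) x * |u x| ^ (p + 1)
      = ∫ x, divergence (cutField χ) x * |u x| ^ (p + 1) := by
    rw [← integral_finsetSum _ fun i _ => ipw ((hX i).pderiv i)]
    simp only [divergence, Finset.sum_mul]
  have idiv : Integrable (fun x => divergence (cutField χ) x * |u x| ^ (p + 1)) volume := by
    have := integrable_finsetSum Finset.univ fun i _ => ipw ((hX i).pderiv i)
    simpa only [divergence, Finset.sum_mul] using this
  -- the field part
  have S1 : ∫ x, (∑ i, cutField χ i x * G i x) * (potential u x * u x)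
      = - (μ * ((p + 1)⁻¹ * ∫ x, divergence (cutField χ) x * |u x| ^ (p + 1)))
        + ∑ i, ∑ j, ∫ x, cutField χ i x * H j j x * G i x := by
    have e : ∫ x, (∑ i, cutField χ i x * G i x) * (potential u x * u x)
        = ∑ i, ∫ x, cutField χ i x * (potential u x * u x) * G i x := by
      rw [← integral_finsetSum _ fun i _ =>
        hpu.integrable_mul_mul (h.mem_grad i) (hX i).smooth.continuous (hX i).compact]
      refine integral_congr_ae (Eventually.of_forall fun x => ?_)
      simp only [Finset.sum_mul]
      exact Finset.sum_congr rfl fun i _ => by ring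
    rw [e]
    simp only [test (hX _) (h.mem_grad _), power, Finset.sum_add_distrib, ← Finset.mul_sum,
      Finset.sum_neg_distrib, hdiv]
    ring
  -- the zeroth order part
  have S2 : ∫ x, χ x * (potential u x * u x) * u x
      = μ * (∫ x, χ x * |u x| ^ (p + 1)) + ∑ j, ∫ x, χ x * H j j x * u x := by
    rw [test hχ h.mem]
    congr 2
    refine integral_congr_ae (Eventually.of_forall fun x => ?_)
    dsimp only
    have : |u x| ^ (p + 1) = |u x| ^ (p - 1) * (u x * u x) := by
      rw [show p + 1 = (p - 1) + (2 : ℕ) by push_cast; ring,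
        Real.rpow_add_natCast' (abs_nonneg _) (by push_cast; linarith), sq_abs, sq]
    rw [this]
    ring
  have hχu : AEStronglyMeasurable (fun x => χ x * u x) volume :=
    hχ.smooth.continuous.aestronglyMeasurable.mul hmu
  have iχ : Integrable (fun x => χ x * u x * (potential u x * u x)) volume :=
    h.mem.integrable_mul_mul hpu hχ.smooth.continuous hχ.compact
  -- The constant `4π` here is `8π` times the weight `½` of `u` in the multiplier, so it matches the
  -- `8π` of `K1`.
  have K2 := integral_mul_kernel hmu hc hχu iχ
  have K2i := integrable_mul_kernel hmu hc hχu iχ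
  have K1 := h.nonlocal hc hpu hX
  have e2 : ∫ x, χ x * u x * (potential u x * u x) = ∫ x, χ x * (potential u x * u x) * u x :=
    integral_congr_ae (Eventually.of_forall fun x => by dsimp only; ring)
  obtain ⟨L, hL0, hL⟩ := exists_common_bound
    (P := fun i C => ∀ x y, |cutField χ i x - cutField χ i y| ≤ C * ‖x - y‖)
    (fun i a b hab h x y => (h x y).trans (by gcongr)) fun i => (hX i).exists_lipschitz
  obtain ⟨C, hC⟩ := exists_abs_divergence_le hX
  have K1i : Integrable (fun z : R3 × R3 => u z.1 ^ 2 * u z.2 ^ 2 *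
      pohozaevKernel (cutField χ) z) (volume.prod volume) :=
    integrable_mul_coulombDensity hmu hc (measurable_pohozaevKernel hX)
      fun z hz => abs_pohozaevKernel_le hL0 hC hL hz (by positivity) le_rfl
  have e3 : ∫ x, ((1 / 2) * χ x - (p + 1)⁻¹ * divergence (cutField χ) x) * |u x| ^ (p + 1)
      = (1 / 2) * (∫ x, χ x * |u x| ^ (p + 1))
        - (p + 1)⁻¹ * ∫ x, divergence (cutField χ) x * |u x| ^ (p + 1) := by
    rw [← integral_const_mul, ← integral_const_mul,
      ← integral_sub ((ipw hχ).const_mul _) (idiv.const_mul _)]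
    refine integral_congr_ae (Eventually.of_forall fun x => ?_)
    dsimp only
    ring
  have e4 : ∫ z : R3 × R3, u z.1 ^ 2 * u z.2 ^ 2 *
        (χ z.1 * (1 / ‖z.1 - z.2‖) - pohozaevKernel (cutField χ) z) ∂(volume.prod volume)
      = (∫ z : R3 × R3, χ z.1 * u z.1 * u z.1 * (u z.2 ^ 2 * (1 / ‖z.1 - z.2‖))
          ∂(volume.prod volume)) - ∫ z : R3 × R3, u z.1 ^ 2 * u z.2 ^ 2 *
        pohozaevKernel (cutField χ) z ∂(volume.prod volume) := by
    rw [← integral_sub K2i K1i]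
    refine integral_congr_ae (Eventually.of_forall fun z => ?_)
    dsimp only
    ring
  have hg := h.integral_hess_mul_multiplier hχ
  rw [e4, K2, e2, S2, e3, ← hg]
  rw [S1] at K1
  linear_combination -K1

end

/-! ### A radial cutoff and its dilations -/

/-- A smooth radially decreasing cutoff function. -/
def cutoff (x : R3) : ℝ := Real.smoothTransition (2 - ‖x‖ ^ 2)

lemma isTestFunction_cutoff : IsTestFunction cutoff := by
  refine ⟨Real.smoothTransition.contDiff.comp (contDiff_const.sub (contDiff_id.norm_sq ℝ)),
    HasCompactSupport.of_support_subset_isCompact (isCompact_closedBall (0 : R3) 2) ?_⟩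
  intro x hx
  rw [mem_closedBall_zero_iff]
  by_contra hlt
  refine hx (Real.smoothTransition.zero_of_nonpos ?_)
  nlinarith [not_le.1 hlt]

lemma cutoff_nonneg (x : R3) : 0 ≤ cutoff x := Real.smoothTransition.nonneg _

lemma cutoff_eq_one {x : R3} (hx : ‖x‖ ≤ 1) : cutoff x = 1 :=
  Real.smoothTransition.one_of_one_le (by nlinarith [norm_nonneg x])

/-- The gradient of a radially decreasing function is a nonpositive multiple of `x`. This gives
`div(χ x) ≤ 3χ`, hence the sign of the power term. -/
lemma partialDeriv_cutoff_mul_nonpos (i : Fin 3) (x : R3) : partialDeriv i cutoff x * x i ≤ 0 := by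
  have h1 : HasFDerivAt (fun x : R3 => 2 - ‖x‖ ^ 2) (-(2 • innerSL ℝ x)) x := by
    have h := ((hasFDerivAt_id x).norm_sq).const_sub 2
    simpa using! h
  have hs : Differentiable ℝ Real.smoothTransition :=
    (Real.smoothTransition.contDiff (n := 1)).differentiable (by simp)
  have h2 := ((hs (2 - ‖x‖ ^ 2)).hasDerivAt.comp_hasFDerivAt x h1).fderiv
  have h3 : 0 ≤ deriv Real.smoothTransition (2 - ‖x‖ ^ 2) :=
    Real.smoothTransition.monotone.deriv_nonneg
  have h4 : partialDeriv i cutoff x = -(deriv Real.smoothTransition (2 - ‖x‖ ^ 2) * (2 * x i)) := by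
    simp only [partialDeriv]
    change fderiv ℝ (Real.smoothTransition ∘ fun x : R3 => 2 - ‖x‖ ^ 2) x _ = _
    rw [h2]
    simp [EuclideanSpace.inner_single_right]
  rw [h4]
  nlinarith [mul_nonneg h3 (sq_nonneg (x i))]

lemma partialDeriv_cutoff_eq_zero (i : Fin 3) {x : R3} (hx : ‖x‖ < 1) :
    partialDeriv i cutoff x = 0 := by
  have h : cutoff =ᶠ[𝓝 x] fun _ => (1 : ℝ) := by
    filter_upwards [Metric.isOpen_ball.mem_nhds (mem_ball_zero_iff.2 hx)] with y hy
    exact cutoff_eq_one (mem_ball_zero_iff.1 hy).le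
  simp only [partialDeriv]
  rw [h.fderiv_eq]
  simp

/-- The dilated cutoff functions `χ(x / (n + 1))`. -/
def cutoffSeq (n : ℕ) (x : R3) : ℝ := cutoff ((1 / ((n : ℝ) + 1)) • x)

lemma isTestFunction_cutoffSeq (n : ℕ) : IsTestFunction (cutoffSeq n) := by
  have hn : (1 / ((n : ℝ) + 1)) ≠ 0 := by positivity
  exact ⟨isTestFunction_cutoff.smooth.comp (contDiff_const_smul _),
    isTestFunction_cutoff.compact.comp_homeomorph (Homeomorph.smulOfNeZero _ hn)⟩

lemma partialDeriv_cutoffSeq (n : ℕ) (i : Fin 3) (x : R3) :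
    partialDeriv i (cutoffSeq n) x
      = (1 / ((n : ℝ) + 1)) * partialDeriv i cutoff ((1 / ((n : ℝ) + 1)) • x) := by
  simp only [partialDeriv]
  change fderiv ℝ (fun x => cutoff ((1 / ((n : ℝ) + 1)) • x)) x _ = _
  rw [fderiv_comp_smul]
  simp

/-- Scale invariance of `xᵢ ∂ⱼχ`: its dilates share one bound and tend to the value at the origin,
which is zero. -/
lemma partialDeriv_cutoffSeq_mul (n : ℕ) (i j : Fin 3) (x : R3) :
    partialDeriv j (cutoffSeq n) x * x i
      = (fun y : R3 => partialDeriv j cutoff y * y i) ((1 / ((n : ℝ) + 1)) • x) := by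
  rw [partialDeriv_cutoffSeq]
  simp only [PiLp.smul_apply, smul_eq_mul]
  ring

lemma tendsto_dilate (x : R3) :
    Tendsto (fun n : ℕ => (1 / ((n : ℝ) + 1)) • x) atTop (𝓝 0) := by
  simpa using (tendsto_one_div_add_atTop_nhds_zero_nat (𝕜 := ℝ)).smul_const x

lemma tendsto_integral_dilate {k f : R3 → ℝ} {C : ℝ} (hk : Continuous k) (hC : ∀ x, |k x| ≤ C)
    (hk0 : k 0 = 0) (hf : Integrable f volume) :
    Tendsto (fun n : ℕ => ∫ x, k ((1 / ((n : ℝ) + 1)) • x) * f x) atTop (𝓝 0) := by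
  have h := tendsto_integral_of_dominated_convergence (μ := (volume : Measure R3))
    (F := fun (n : ℕ) x => k ((1 / ((n : ℝ) + 1)) • x) * f x) (f := fun _ => (0 : ℝ))
    (fun x => C * ‖f x‖)
    (fun n => ((hk.comp (continuous_const_smul _)).aestronglyMeasurable.mul hf.1))
    (hf.norm.const_mul C)
    (fun n => Eventually.of_forall fun x => by
      rw [norm_mul]
      exact mul_le_mul_of_nonneg_right (hC _) (norm_nonneg _))
    (Eventually.of_forall fun x => by
      have := ((hk.tendsto 0).comp (tendsto_dilate x)).mul_const (f x)
      simpa [hk0] using! this)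
  simpa using h

lemma tendsto_integral_partialDeriv_cutoffSeq_mul {f g : R3 → ℝ} (hf : MemLp f 2 volume)
    (hg : MemLp g 2 volume) (i j : Fin 3) :
    Tendsto (fun n : ℕ => ∫ x, partialDeriv j (cutoffSeq n) x * x i * f x * g x) atTop (𝓝 0) := by
  have ht : IsTestFunction fun y : R3 => partialDeriv j cutoff y * y i :=
    (isTestFunction_cutoff.pderiv j).mul_right (contDiff_coord i)
  obtain ⟨C, hC⟩ := ht.exists_abs_le
  have hfg : Integrable (fun x => f x * g x) volume := hf.integrable_mul hg
  have h := tendsto_integral_dilate ht.smooth.continuous hC (by simp) hfg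
  refine h.congr fun n => ?_
  refine integral_congr_ae (Eventually.of_forall fun x => ?_)
  dsimp only
  rw [partialDeriv_cutoffSeq_mul]
  ring

/-- `L³` is the scale-invariant norm of a gradient in dimension three: the cubed factor of the chain
rule cancels the Jacobian. -/
lemma integral_abs_partialDeriv_cutoffSeq_pow_three (n : ℕ) (j : Fin 3) :
    ∫ x, |partialDeriv j (cutoffSeq n) x| ^ 3 = ∫ x, |partialDeriv j cutoff x| ^ 3 := by
  have hε : (0 : ℝ) < 1 / ((n : ℝ) + 1) := by positivity
  have hpt : ∀ x, |partialDeriv j (cutoffSeq n) x| ^ 3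
      = (1 / ((n : ℝ) + 1)) ^ 3
        * (fun y => |partialDeriv j cutoff y| ^ 3) ((1 / ((n : ℝ) + 1)) • x) := by
    intro x
    rw [partialDeriv_cutoffSeq, abs_mul, mul_pow, abs_of_pos hε]
  simp only [hpt]
  rw [integral_const_mul,
    Measure.integral_comp_smul volume (fun y => |partialDeriv j cutoff y| ^ 3)]
  have hfr : Module.finrank ℝ R3 = 3 := by simp
  rw [hfr, abs_of_pos (by positivity), smul_eq_mul, mul_inv_cancel_left₀ (by positivity)]

/-- A pointwise substitute for the Hölder inequality `L³ · L⁶ ⊆ L²`: `a²b²` is at most the cube of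
the larger of `|a|` and `b²`. -/
lemma sq_mul_sq_le_pow_three_add_pow_six (a b : ℝ) : (a * b) ^ 2 ≤ |a| ^ 3 + |b| ^ 6 := by
  have e1 : (a * b) ^ 2 = |a| ^ 2 * |b| ^ 2 := by rw [mul_pow, sq_abs, sq_abs]
  have e2 : |b| ^ 6 = (|b| ^ 2) ^ 3 := by ring
  rw [e1, e2]
  have ha0 : 0 ≤ |a| := abs_nonneg _
  have hb0 : 0 ≤ |b| ^ 2 := by positivity
  generalize |a| = c at *
  generalize |b| ^ 2 = d at *
  rcases le_total c d with hab | hab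
  · have : c ^ 2 * d ≤ d ^ 2 * d := by gcongr
    nlinarith [pow_nonneg ha0 3]
  · have : c ^ 2 * d ≤ c ^ 2 * c := by gcongr
    nlinarith [pow_nonneg hb0 3]

lemma integrable_abs_pow_three {f : R3 → ℝ} (hf : IsTestFunction f) :
    Integrable (fun x => |f x| ^ 3) volume := by
  have hc : HasCompactSupport fun x => |f x| ^ 3 :=
    hf.compact.mono fun x hx h0 => hx (by simp [h0])
  have hcont : Continuous fun x => |f x| ^ 3 := hf.smooth.continuous.abs.pow 3
  exact hcont.integrable_of_hasCompactSupport hc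

lemma memLp_partialDeriv_cutoffSeq_mul {u : R3 → ℝ} (hu2 : MemL2loc u) (n : ℕ) (j : Fin 3) :
    MemLp (fun x => partialDeriv j (cutoffSeq n) x * u x) 2 volume := by
  have hc := (isTestFunction_cutoffSeq n).pderiv j
  have hcc := hc.mul_right hc.smooth
  have hm : AEStronglyMeasurable (fun x => partialDeriv j (cutoffSeq n) x * u x) volume :=
    hc.smooth.continuous.aestronglyMeasurable.mul hu2.aestronglyMeasurable
  refine (memLp_two_iff_integrable_sq hm).2 ?_
  refine (hu2.integrable_mul_mul hu2 hcc.smooth.continuous hcc.compact).congr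
    (Eventually.of_forall fun x => ?_)
  dsimp only
  ring

lemma integral_partialDeriv_cutoffSeq_mul_sq_le {u : R3 → ℝ} (hu : MemLp u 6 volume)
    (hu2 : MemL2loc u) (n : ℕ) (j : Fin 3) :
    ∫ x, (partialDeriv j (cutoffSeq n) x * u x) ^ 2
      ≤ (∫ x, |partialDeriv j cutoff x| ^ 3) + ∫ x, |u x| ^ 6 := by
  have hu' : MemLp u ((6 : ℕ) : ℝ≥0∞) volume := by simpa using hu
  have hu6 : Integrable (fun x => |u x| ^ 6) volume := by
    have h := hu'.integrable_norm_pow (by norm_num)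
    simpa only [Real.norm_eq_abs] using h
  have hi3 := integrable_abs_pow_three ((isTestFunction_cutoffSeq n).pderiv j)
  rw [← integral_abs_partialDeriv_cutoffSeq_pow_three n j, ← integral_add hi3 hu6]
  exact integral_mono (memLp_partialDeriv_cutoffSeq_mul hu2 n j).integrable_sq (hi3.add hu6)
    fun x => sq_mul_sq_le_pow_three_add_pow_six _ _

lemma abs_integral_mul_le {f g : R3 → ℝ} (hf : MemLp f 2 volume) (hg : MemLp g 2 volume) :
    |∫ x, f x * g x| ≤ (∫ x, f x ^ 2) ^ (1 / 2 : ℝ) * (∫ x, g x ^ 2) ^ (1 / 2 : ℝ) := by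
  have h := integral_mul_norm_le_Lp_mul_Lq (μ := (volume : Measure R3))
    (Real.HolderConjugate.two_two) (f := f) (g := g) (by simpa using hf) (by simpa using hg)
  simp only [Real.rpow_two, Real.norm_eq_abs, sq_abs] at h
  refine (abs_integral_le_integral_abs).trans (le_trans (le_of_eq ?_) h)
  simp only [abs_mul]

/-- The cross term `∫ u ∇u · ∇χ_R` tends to `0`: `∇χ_R` is bounded in `L³`, `u ∈ L⁶`, and the part
of `∇u` on the support of `∇χ_R` tends to `0` in `L²`. -/
lemma tendsto_integral_partialDeriv_cutoffSeq_cross {f u : R3 → ℝ} (hf : MemLp f 2 volume)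
    (hu : MemLp u 6 volume) (hu2 : MemL2loc u) (j : Fin 3) :
    Tendsto (fun n : ℕ => ∫ x, partialDeriv j (cutoffSeq n) x * f x * u x) atTop (𝓝 0) := by
  -- The weight `m` equals `1` where `∇χ` can be nonzero, so it can be inserted for free. It
  -- vanishes at `0`, so its dilates times `f` tend to `0` in `L²`; being continuous, it serves in
  -- place of an indicator.
  let m : R3 → ℝ := fun y => min ‖y‖ 1
  have hmc : Continuous m := continuous_norm.min continuous_const
  have hm0 : ∀ y, 0 ≤ m y := fun y => le_min (norm_nonneg _) zero_le_one
  have hm1 : ∀ y, |m y ^ 2| ≤ 1 := fun y => by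
    rw [abs_of_nonneg (pow_nonneg (hm0 y) 2)]
    exact pow_le_one₀ (hm0 y) (min_le_right _ _)
  have hgm : ∀ y, partialDeriv j cutoff y = partialDeriv j cutoff y * m y := by
    intro y
    by_cases hy : ‖y‖ < 1
    · rw [partialDeriv_cutoff_eq_zero j hy, zero_mul]
    · simp [m, min_eq_right (not_lt.1 hy)]
  have ht := tendsto_integral_dilate (k := fun y => m y ^ 2) (hmc.pow 2) hm1 (by simp [m])
    hf.integrable_sq
  set M : ℝ := (∫ x, |partialDeriv j cutoff x| ^ 3) + ∫ x, |u x| ^ 6 with hM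
  have hmf : ∀ n : ℕ, MemLp (fun x => m ((1 / ((n : ℝ) + 1)) • x) * f x) 2 volume := by
    intro n
    refine hf.of_le ((hmc.comp (continuous_const_smul _)).aestronglyMeasurable.mul hf.1)
      (Eventually.of_forall fun x => ?_)
    rw [norm_mul, Real.norm_of_nonneg (hm0 _)]
    exact mul_le_of_le_one_left (norm_nonneg _) (min_le_right _ _)
  have hbound : ∀ n : ℕ, ‖∫ x, partialDeriv j (cutoffSeq n) x * f x * u x‖
      ≤ (∫ x, m ((1 / ((n : ℝ) + 1)) • x) ^ 2 * f x ^ 2) ^ (1 / 2 : ℝ) * M ^ (1 / 2 : ℝ) := by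
    intro n
    have h1 := abs_integral_mul_le (hmf n) (memLp_partialDeriv_cutoffSeq_mul hu2 n j)
    have e1 : ∀ x, partialDeriv j (cutoffSeq n) x * f x * u x
        = m ((1 / ((n : ℝ) + 1)) • x) * f x * (partialDeriv j (cutoffSeq n) x * u x) := by
      intro x
      rw [partialDeriv_cutoffSeq]
      nth_rewrite 1 [hgm]
      ring
    simp only [e1, Real.norm_eq_abs]
    simp only [mul_pow (m _) (f _)] at h1
    refine h1.trans (mul_le_mul_of_nonneg_left ?_
      (Real.rpow_nonneg (integral_nonneg fun x => by positivity) _))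
    exact Real.rpow_le_rpow (integral_nonneg fun x => sq_nonneg _)
      (integral_partialDeriv_cutoffSeq_mul_sq_le hu hu2 n j) (by norm_num)
  refine squeeze_zero_norm hbound ?_
  have := (ht.rpow_const (p := (1 / 2 : ℝ)) (Or.inr (by norm_num))).mul_const (M ^ (1 / 2 : ℝ))
  rwa [Real.zero_rpow (by norm_num), zero_mul] at this

lemma tendsto_gradientError {u : R3 → ℝ} {G : Fin 3 → R3 → ℝ} (hu : MemLp u 6 volume)
    (hu2 : MemL2loc u) (hG : ∀ i, MemLp (G i) 2 volume) :
    Tendsto (fun n => gradientError u G (cutoffSeq n)) atTop (𝓝 0) := by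
  have h1 : Tendsto (fun n => gradientError u G (cutoffSeq n)) atTop
      (𝓝 ((∑ _i : Fin 3, ∑ _j : Fin 3, ((1 / 2) * (0 : ℝ) - 0))
        - (1 / 2) * ∑ _j : Fin 3, (0 : ℝ))) := by
    refine Tendsto.sub ?_ (Tendsto.const_mul _ (tendsto_finsetSum _ fun j _ => ?_))
    · refine tendsto_finsetSum _ fun i _ => tendsto_finsetSum _ fun j _ => ?_
      exact ((tendsto_integral_partialDeriv_cutoffSeq_mul (hG j) (hG j) i i).const_mul _).sub
        (tendsto_integral_partialDeriv_cutoffSeq_mul (hG j) (hG i) i j)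
    · exact tendsto_integral_partialDeriv_cutoffSeq_cross (hG j) hu hu2 j
  simpa using h1

/-! ### Passage to the limit in the localized Pohozaev identity -/

lemma divergence_cutField_cutoffSeq (n : ℕ) (x : R3) :
    divergence (cutField (cutoffSeq n)) x
      = divergence (cutField cutoff) ((1 / ((n : ℝ) + 1)) • x) := by
  rw [divergence_cutField (isTestFunction_cutoffSeq n).smooth,
    divergence_cutField isTestFunction_cutoff.smooth]
  simp only [partialDeriv_cutoffSeq_mul, cutoffSeq]

lemma divergence_cutField_cutoffSeq_le (n : ℕ) (x : R3) :
    divergence (cutField (cutoffSeq n)) x ≤ 3 * cutoffSeq n x := by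
  rw [divergence_cutField (isTestFunction_cutoffSeq n).smooth]
  have : ∑ i, partialDeriv i (cutoffSeq n) x * x i ≤ 0 :=
    Finset.sum_nonpos fun i _ => by
      rw [partialDeriv_cutoffSeq_mul]
      exact partialDeriv_cutoff_mul_nonpos i _
  linarith

lemma cutField_cutoffSeq (n : ℕ) (i : Fin 3) (x : R3) :
    cutField (cutoffSeq n) i x
      = ((n : ℝ) + 1) * cutField cutoff i ((1 / ((n : ℝ) + 1)) • x) := by
  simp only [cutField, cutoffSeq, PiLp.smul_apply, smul_eq_mul]
  field_simp

/-- The dilated field is `(n+1) X(x/(n+1))`, a scaling that preserves Lipschitz constants.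
Uniformity in `n` gives a common dominating function for the Coulomb terms. -/
lemma exists_forall_cutField_cutoffSeq_lipschitz : ∃ L : ℝ, 0 ≤ L ∧ ∀ (n : ℕ) (i : Fin 3) (x y : R3),
    |cutField (cutoffSeq n) i x - cutField (cutoffSeq n) i y| ≤ L * ‖x - y‖ := by
  obtain ⟨L, hL0, hL⟩ := exists_common_bound
    (P := fun i C => ∀ x y, |cutField cutoff i x - cutField cutoff i y| ≤ C * ‖x - y‖)
    (fun i a b hab h x y => (h x y).trans (by gcongr))
    fun i => (isTestFunction_cutoff.cutField i).exists_lipschitz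
  refine ⟨L, hL0, fun n i x y => ?_⟩
  have hn : (0 : ℝ) < (n : ℝ) + 1 := by positivity
  rw [cutField_cutoffSeq, cutField_cutoffSeq, ← mul_sub, abs_mul, abs_of_pos hn]
  calc _ ≤ ((n : ℝ) + 1) * (L * ‖(1 / ((n : ℝ) + 1)) • x - (1 / ((n : ℝ) + 1)) • y‖) := by
        gcongr
        exact hL i _ _
    _ = L * ‖x - y‖ := by
        rw [← smul_sub, norm_smul, Real.norm_of_nonneg (by positivity)]
        field_simp

lemma eventually_norm_dilate_lt (x : R3) :
    ∀ᶠ n : ℕ in atTop, ‖(1 / ((n : ℝ) + 1)) • x‖ < 1 := by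
  have h := (tendsto_dilate x).norm
  rw [norm_zero] at h
  exact h.eventually (gt_mem_nhds one_pos)

lemma sum_coord_mul_self (z : R3) : ∑ i, z i * z i = ‖z‖ ^ 2 := by
  rw [EuclideanSpace.real_norm_sq_eq]
  exact Finset.sum_congr rfl fun i _ => (sq _).symm

/-- Once both points lie where the cutoff is `1`, the field is `x`, with divergence `3` and pairing
`|x-y|²`; the coefficient is `1 - (3 - ½) = -3/2`. -/
lemma eventually_kernel_eq {z : R3 × R3} (hz : z.1 - z.2 ≠ 0) :
    ∀ᶠ n : ℕ in atTop, cutoffSeq n z.1 * (1 / ‖z.1 - z.2‖)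
      - pohozaevKernel (cutField (cutoffSeq n)) z = -(3 / 2) * (1 / ‖z.1 - z.2‖) := by
  filter_upwards [eventually_norm_dilate_lt z.1, eventually_norm_dilate_lt z.2] with n h1 h2
  have c1 : cutoffSeq n z.1 = 1 := cutoff_eq_one h1.le
  have c2 : cutoffSeq n z.2 = 1 := cutoff_eq_one h2.le
  have hd : divergence (cutField (cutoffSeq n)) z.1 = 3 := by
    rw [divergence_cutField (isTestFunction_cutoffSeq n).smooth, c1]
    simp only [partialDeriv_cutoffSeq, partialDeriv_cutoff_eq_zero _ h1]
    simp
  have hs : symmPairing (cutField (cutoffSeq n)) z = ‖z.1 - z.2‖ ^ 2 := by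
    simp only [symmPairing, cutField, c1, c2, one_mul]
    exact sum_coord_mul_self (z.1 - z.2)
  have hz' : ‖z.1 - z.2‖ ≠ 0 := norm_ne_zero_iff.2 hz
  rw [pohozaevKernel, c1, hd, hs]
  field_simp
  ring

lemma tendsto_integral_kernel {u : R3 → ℝ} (hu : AEStronglyMeasurable u volume)
    (hc : Integrable (coulombDensity u) (volume.prod volume)) :
    Tendsto (fun n : ℕ => ∫ z : R3 × R3, u z.1 ^ 2 * u z.2 ^ 2 *
        (cutoffSeq n z.1 * (1 / ‖z.1 - z.2‖) - pohozaevKernel (cutField (cutoffSeq n)) z)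
        ∂(volume.prod volume)) atTop
      (𝓝 (-(3 / 2) * ∫ z, coulombDensity u z ∂(volume.prod volume))) := by
  obtain ⟨L, hL0, hL⟩ := exists_forall_cutField_cutoffSeq_lipschitz
  obtain ⟨C, hC⟩ := exists_abs_divergence_le fun i => isTestFunction_cutoff.cutField i
  rw [← integral_const_mul]
  have ht := fun n => isTestFunction_cutoffSeq n
  refine tendsto_integral_of_dominated_convergence
    (fun z => (1 + (C + 2 * L)) * coulombDensity u z) (fun n => ?_) (hc.const_mul _)
    (fun n => ?_) ?_
  · refine (aestronglyMeasurable_sq_mul_sq hu).mul (Measurable.aestronglyMeasurable ?_)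
    exact (((ht n).smooth.continuous.measurable.comp measurable_fst).mul
      measurable_one_div_norm_sub).sub (measurable_pohozaevKernel fun i => (ht n).cutField i)
  · filter_upwards [ae_ne_prod] with z hz
    have h1 : |cutoffSeq n z.1 * (1 / ‖z.1 - z.2‖)| ≤ 1 * (1 / ‖z.1 - z.2‖) := by
      rw [abs_mul, abs_of_nonneg (by positivity : 0 ≤ 1 / ‖z.1 - z.2‖)]
      gcongr
      have h0 : 0 ≤ cutoffSeq n z.1 := cutoff_nonneg _
      rw [abs_of_nonneg h0]
      exact Real.smoothTransition.le_one _
    have h2 : |pohozaevKernel (cutField (cutoffSeq n)) z| ≤ (C + 2 * L) / ‖z.1 - z.2‖ :=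
      abs_pohozaevKernel_le hL0 (fun x => by rw [divergence_cutField_cutoffSeq]; exact hC _)
        (hL n) hz (by positivity) le_rfl
    rw [norm_mul, Real.norm_of_nonneg (by positivity), Real.norm_eq_abs, coulombDensity]
    calc _ ≤ u z.1 ^ 2 * u z.2 ^ 2 *
          (1 * (1 / ‖z.1 - z.2‖) + (C + 2 * L) / ‖z.1 - z.2‖) := by
          gcongr
          exact (abs_sub _ _).trans (add_le_add h1 h2)
      _ = _ := by ring
  · filter_upwards [ae_ne_prod] with z hz
    refine tendsto_const_nhds.congr' ?_
    filter_upwards [eventually_kernel_eq hz] with n hn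
    rw [hn, coulombDensity]
    ring

/-- The nonnegative density must vanish almost everywhere. If `u` were nonzero on a set of positive
measure, some `x` with `u x ≠ 0` would have a null section, which forces `u y = 0` for almost every
`y`. -/
lemma ae_eq_zero_of_integral_coulombDensity {u : R3 → ℝ}
    (hc : Integrable (coulombDensity u) (volume.prod volume))
    (h : ∫ z, coulombDensity u z ∂(volume.prod volume) ≤ 0) : u =ᵐ[volume] 0 := by
  have h0 : ∫ z, coulombDensity u z ∂(volume.prod volume) = 0 :=
    le_antisymm h (integral_nonneg (coulombDensity_nonneg u))
  have hae := (integral_eq_zero_iff_of_nonneg (coulombDensity_nonneg u) hc).1 h0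
  have hsec := Measure.ae_ae_of_ae_prod hae
  by_contra hne
  have hfreq : ∃ᵐ x ∂(volume : Measure R3), u x ≠ 0 := by
    intro hcon
    exact hne (hcon.mono fun x hx => by simpa using hx)
  obtain ⟨x, hx, hxs⟩ := (hfreq.and_eventually hsec).exists
  refine hne ?_
  filter_upwards [hxs, Measure.ae_ne volume x] with y hy hyx
  have hn : ‖x - y‖ ≠ 0 := norm_ne_zero_iff.2 (sub_ne_zero.2 (Ne.symm hyx))
  simpa [coulombDensity, hx, hn] using! hy

/-- Nonexistence: weak solutions in `E ∩ H²_loc(ℝ³)` vanish almost everywhere if `p ≥ 5`. -/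
theorem IsWeakSolution.ae_eq_zero {μ p : ℝ} (hμ : 0 < μ) (hp : 5 ≤ p) {u : R3 → ℝ} (hu : MemE u)
    (hloc : MemH2loc u) (hsol : IsWeakSolution μ p u) : u =ᵐ[volume] 0 := by
  obtain ⟨⟨hu6, G', hG', hG'2⟩, hE⟩ := hu
  obtain ⟨hu2, G, H, hG, hGm, hH, hHm⟩ := hloc
  have h : IsH2loc u G H := ⟨hu2, hG, hGm, hH, hHm⟩
  -- The local gradient inherits global square integrability from the one in `D^{1,2}`.
  have hG2 : ∀ i, MemLp (G i) 2 volume := fun i =>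
    (memLp_congr_ae ((hG' i).ae_eq (hG i))).1 (hG'2 i)
  have hc := integrable_coulombDensity hu6.1 hE
  refine ae_eq_zero_of_integral_coulombDensity hc ?_
  have t1 := tendsto_integral_kernel hu6.1 hc
  have t2 := (tendsto_gradientError hu6 hu2 hG2).const_mul (8 * Real.pi)
  rw [mul_zero] at t2
  -- For each `n` the Coulomb side is at least `8π` times the gradient error, because the power term
  -- is nonnegative; only these two sides are passed to the limit.
  have hle : 0 ≤ -(3 / 2) * ∫ z, coulombDensity u z ∂(volume.prod volume) := by
    refine le_of_tendsto_of_tendsto' t2 t1 fun n => ?_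
    rw [h.pohozaev (by linarith) hsol hc (isTestFunction_cutoffSeq n)]
    have hP : 0 ≤ ∫ x, ((1 / 2) * cutoffSeq n x
        - (p + 1)⁻¹ * divergence (cutField (cutoffSeq n)) x) * |u x| ^ (p + 1) := by
      refine integral_nonneg fun x => mul_nonneg ?_ (Real.rpow_nonneg (abs_nonneg _) _)
      have h1 := divergence_cutField_cutoffSeq_le n x
      -- The threshold `p = 5`: the bound `div(χ x) ≤ 3χ` divided by `p + 1 ≥ 6` is at most `χ/2`.
      have h2 : (p + 1)⁻¹ ≤ 6⁻¹ := inv_anti₀ (by norm_num) (by linarith)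
      have h3 : 0 ≤ cutoffSeq n x := cutoff_nonneg _
      have h4 : 0 ≤ (p + 1)⁻¹ := inv_nonneg.2 (by linarith)
      have h5 := mul_le_mul_of_nonneg_left h1 h4
      have h6 := mul_le_mul_of_nonneg_right h2 (by linarith : 0 ≤ 3 * cutoffSeq n x)
      linarith
    have hpi := Real.pi_pos
    have := mul_nonneg hμ.le hP
    gcongr
    linarith
  linarith

end SchrodingerPoissonSlater

end

end

theorem corollary2p5 (μ p : ℝ) (hμ : 0 < μ) (hp : 5 ≤ p) :
    ¬ ∃ u : SchrodingerPoissonSlater.R3 → ℝ,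
      SchrodingerPoissonSlater.MemE u ∧ SchrodingerPoissonSlater.MemH2loc u ∧
      SchrodingerPoissonSlater.IsWeakSolution μ p u ∧
      ¬ (u =ᵐ[MeasureTheory.volume] 0) := by
  rintro ⟨u, hu, hloc, hsol, hne⟩
  exact hne (hsol.ae_eq_zero hμ hp hu hloc)
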